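/- Let $\mathcal H$ be a complex Hilbert space and let $\mathcal C_1^{\rm sa}$ be the real Banach space of self-adjoint trace-class operators on $\mathcal H$ with the trace norm, ordered by $u\ge 0$ iff $(ux,x)\ge 0$ for all $x\in\mathcal H$. For a subspace $D\subset\mathcal C_1^{\rm sa}$ write $D^+=\{u\in D:u\ge0\}$; a linear operator $A\colon D\to\mathcal C_1^{\rm sa}$ is positivity preserving if $Au\ge0$ for all $u\in D^+$, and $A\le B$ means that $B-A$ is positivity preserving. A dynamical semigroup is a positivity preserving contraction $C_0$-semigroup on $\mathcal C_1^{\rm sa}$; it is a Markov dynamical semigroup if moreover it is trace preserving, i.e. $\mathrm{Tr}(T_tu)=\mathrm{Tr}\,u$ for all $t>0$ and $u\in\mathcal C_1^{\rm sa}$. Let $-H$ be the generator of a dynamical semigroup and let $K\colon D(H)\to\mathcal C_1^{\rm sa}$ be a positivity preserving operator with $\mathrm{Tr}(Ku)\le\mathrm{Tr}(Hu)$ for all $u\in D(H)^+$. Let $(K_\alpha)_{\alpha\in J}$ be a functional regularisation of $K$, that is, a net of linear operators $K_\alpha\colon D(H)\to\mathcal C_1^{\rm sa}$ such that 1. every $K_\alpha$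 is positivity preserving; 2. for every $\alpha$ there are $a_\alpha\in[0,\infty)$ and $b_\alpha\in[0,1)$ with $\mathrm{Tr}(K_\alpha u)\le a_\alpha\mathrm{Tr}\,u+b_\alpha\mathrm{Tr}(Hu)$ for all $u\in D(H)^+$; 3. $K_\alpha\le K_\beta\le K$ whenever $\alpha\le\beta$; 4. for every $u\in D(H)^+$ there is a dense subspace $V$ of $\mathcal H$ with $\lim_\alpha((K_\alpha u)x,x)=((Ku)x,x)$ for all $x\in V$. Suppose that $\mathrm{Tr}(Hu-Ku)=0$ for all $u\in D(H)$. Then for every $\alpha$ the operator $-(H-K_\alpha)$ with domain $D(H)$ generates a $C_0$-semigroup $(T^\alpha_t)_{t>0}$, and $T_tu=\lim_\alpha T^\alpha_tu$ exists in trace norm for all $t>0$ and $u\in\mathcal C_1^{\rm sa}$, where each $T_t$ is a bounded linear operator. If $D(H)$ is a core for the generator $-L$ of $(T_t)_{t>0}$, then $(T_t)_{t>0}$ is trace preserving, and hence is a Markov dynamical semigroup. -/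

import Mathlib

open Filter Topology
open scoped NNReal ENNReal

noncomputable section

namespace KatoReg

/-! ### Self-adjoint trace-class operators on a complex Hilbert space -/

section TraceClass

set_option linter.unusedSectionVars false

variable {ℋ : Type*} [NormedAddCommGroup ℋ] [InnerProductSpace ℂ ℋ] [CompleteSpace ℋ]

/-- The `[0, ∞]`-valued trace `∑ᵢ (A eᵢ, eᵢ)` of a positive operator `A` with respect to a
Hilbert basis `e`. -/
def posTraceOn {ι : Type*} (e : HilbertBasis ι ℂ ℋ) (A : ℋ →L[ℂ] ℋ) : ℝ≥0∞ :=
  ∑' i, ENNReal.ofReal (inner ℂ (e i) (A (e i))).re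

variable (ℋ) in
/-- The index set of a fixed Hilbert basis of `ℋ`. -/
def basisIndex : Set ℋ := (exists_hilbertBasis ℂ ℋ).choose

variable (ℋ) in
/-- A fixed Hilbert basis of `ℋ`. -/
def stdBasis : HilbertBasis (basisIndex ℋ) ℂ ℋ := (exists_hilbertBasis ℂ ℋ).choose_spec.choose

/-- The `[0, ∞]`-valued trace of a positive operator; it does not depend on the basis, see
`posTraceOn_eq`. -/
def posTrace (A : ℋ →L[ℂ] ℋ) : ℝ≥0∞ := posTraceOn (stdBasis ℋ) A

/-- An operator `u` is of trace class if `Tr |u| < ∞`, where `|u| = (u* u)^{1/2}`. -/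
def IsTraceClass (u : ℋ →L[ℂ] ℋ) : Prop := posTrace (CFC.abs u) < ∞

lemma tsum_inner_sq {ι : Type*} (e : HilbertBasis ι ℂ ℋ) (x : ℋ) :
    ∑' i, ENNReal.ofReal (‖inner ℂ (e i) x‖ ^ 2) = ENNReal.ofReal (‖x‖ ^ 2) := by
  have h := e.hasSum_inner_mul_inner x x
  have h2 : HasSum (fun i => ‖inner ℂ (e i) x‖ ^ 2) (‖x‖ ^ 2) := by
    have h3 := Complex.hasSum_re h
    convert h3 using 1
    · funext i
      rw [← inner_conj_symm x (e i), ← Complex.normSq_eq_conj_mul_self, Complex.ofReal_re,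
        Complex.normSq_eq_norm_sq]
    · rw [inner_self_eq_norm_sq_to_K]
      norm_cast
  rw [← h2.tsum_eq]
  exact (ENNReal.ofReal_tsum_of_nonneg (fun i => by positivity) h2.summable).symm

lemma inner_eq_norm_sqrt {A : ℋ →L[ℂ] ℋ} (hA : 0 ≤ A) (x : ℋ) :
    (inner ℂ x (A x)).re = ‖CFC.sqrt A x‖ ^ 2 := by
  have hs : IsSelfAdjoint (CFC.sqrt A) := IsSelfAdjoint.of_nonneg (CFC.sqrt_nonneg A)
  have hsym := ContinuousLinearMap.isSelfAdjoint_iff_isSymmetric.mp hs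
  conv_lhs => rw [← CFC.sqrt_mul_sqrt_self A hA]
  have : inner ℂ x ((CFC.sqrt A * CFC.sqrt A) x) = inner ℂ (CFC.sqrt A x) (CFC.sqrt A x) :=
    (hsym x (CFC.sqrt A x)).symm
  rw [this, inner_self_eq_norm_sq_to_K]
  norm_cast

/-- The trace of a positive operator does not depend on the basis. -/
lemma posTraceOn_eq {ι κ : Type*} (e : HilbertBasis ι ℂ ℋ) (f : HilbertBasis κ ℂ ℋ)
    {A : ℋ →L[ℂ] ℋ} (hA : 0 ≤ A) : posTraceOn e A = posTraceOn f A := by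
  have hs : IsSelfAdjoint (CFC.sqrt A) := IsSelfAdjoint.of_nonneg (CFC.sqrt_nonneg A)
  have hsym := ContinuousLinearMap.isSelfAdjoint_iff_isSymmetric.mp hs
  unfold posTraceOn
  simp_rw [inner_eq_norm_sqrt hA]
  calc ∑' i, ENNReal.ofReal (‖CFC.sqrt A (e i)‖ ^ 2)
      = ∑' i, ∑' j, ENNReal.ofReal (‖inner ℂ (f j) (CFC.sqrt A (e i))‖ ^ 2) := by
        simp_rw [tsum_inner_sq f]
    _ = ∑' j, ∑' i, ENNReal.ofReal (‖inner ℂ (f j) (CFC.sqrt A (e i))‖ ^ 2) := ENNReal.tsum_comm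
    _ = ∑' j, ∑' i, ENNReal.ofReal (‖inner ℂ (e i) (CFC.sqrt A (f j))‖ ^ 2) := by
        congr 1; funext j; congr 1; funext i
        rw [← norm_inner_symm (CFC.sqrt A (e i)) (f j)]
        congr 3
        exact hsym (e i) (f j)
    _ = ∑' j, ENNReal.ofReal (‖CFC.sqrt A (f j)‖ ^ 2) := by
        simp_rw [tsum_inner_sq e]

lemma inner_re_nonneg {A : ℋ →L[ℂ] ℋ} (hA : 0 ≤ A) (x : ℋ) : 0 ≤ (inner ℂ x (A x)).re := by
  rw [inner_eq_norm_sqrt hA]; positivity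

lemma posTrace_add {A B : ℋ →L[ℂ] ℋ} (hA : 0 ≤ A) (hB : 0 ≤ B) :
    posTrace (A + B) = posTrace A + posTrace B := by
  unfold posTrace posTraceOn
  rw [← ENNReal.tsum_add]
  congr 1; funext i
  rw [← ENNReal.ofReal_add (inner_re_nonneg hA _) (inner_re_nonneg hB _)]
  simp

/-- If `u ≤ v` with `u` self-adjoint and `v` positive, then `Tr u⁺ ≤ Tr v`. -/
lemma posTrace_posPart_le {u v : ℋ →L[ℂ] ℋ} (hu : IsSelfAdjoint u) (hv : 0 ≤ v) (huv : u ≤ v) :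
    posTrace u⁺ ≤ posTrace v := by
  let K : Submodule ℂ ℋ := (u⁺).range.topologicalClosure
  have hK : IsClosed (K : Set ℋ) := Submodule.isClosed_topologicalClosure _
  have : CompleteSpace K := hK.completeSpace_coe
  obtain ⟨w₀, b₀, hb₀⟩ := exists_hilbertBasis ℂ K
  have hon : Orthonormal ℂ (fun i => ((b₀ i : K) : ℋ)) :=
    b₀.orthonormal.comp_linearIsometry K.subtypeₗᵢ
  have hon' : Orthonormal ℂ ((↑) : Set.range (fun i => ((b₀ i : K) : ℋ)) → ℋ) :=
    hon.toSubtypeRange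
  obtain ⟨w, b, hsw, hb⟩ := hon'.exists_hilbertBasis_extension
  have hpos : 0 ≤ u⁺ := CFC.posPart_nonneg u
  have hneg : 0 ≤ u⁻ := CFC.negPart_nonneg u
  have hposs := ContinuousLinearMap.isSelfAdjoint_iff_isSymmetric.mp (IsSelfAdjoint.of_nonneg hpos)
  have hnegK : ∀ x ∈ K, u⁻ x = 0 := by
    intro x hx
    have hcl : IsClosed {y : ℋ | u⁻ y = 0} := isClosed_eq (u⁻).continuous continuous_const
    have hsub : ((u⁺).range : Set ℋ) ⊆ {y : ℋ | u⁻ y = 0} := by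
      rintro y ⟨z, rfl⟩
      have := congrArg (fun T : ℋ →L[ℂ] ℋ => T z) (CFC.negPart_mul_posPart u)
      exact this
    exact closure_minimal hsub hcl hx
  have hdich : ∀ i : w, (i : ℋ) ∈ K ∨ u⁺ (i : ℋ) = 0 := by
    intro i
    by_cases hi : (i : ℋ) ∈ Set.range (fun i => ((b₀ i : K) : ℋ))
    · obtain ⟨j, hj⟩ := hi
      exact Or.inl (hj ▸ (b₀ j).2)
    · right
      have hperp : ∀ j, inner ℂ ((b₀ j : K) : ℋ) (i : ℋ) = 0 := by
        intro j
        have hj : ((b₀ j : K) : ℋ) ∈ w := hsw ⟨j, rfl⟩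
        have ho := b.orthonormal
        rw [hb] at ho
        refine ho.2 (i := ⟨_, hj⟩) (j := i) ?_
        intro h
        exact hi ⟨j, congrArg Subtype.val h⟩
      have hp : K.orthogonalProjectionOnto (i : ℋ) = 0 := by
        have : b₀.repr (K.orthogonalProjectionOnto (i : ℋ)) = 0 := by
          ext j
          rw [b₀.repr_apply_apply]
          have := hperp j
          simpa using this
        exact (map_eq_zero_iff b₀.repr b₀.repr.injective).mp this
      have hmem : (i : ℋ) ∈ Kᗮ := Submodule.orthogonalProjectionOnto_eq_zero_iff.mp hp
      have h0 : inner ℂ (u⁺ (u⁺ (i : ℋ))) (i : ℋ) = 0 :=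
        hmem _ (Submodule.le_topologicalClosure _ ⟨u⁺ (i : ℋ), rfl⟩)
      have h1 : inner ℂ (u⁺ (u⁺ (i : ℋ))) (i : ℋ) = inner ℂ (u⁺ (i : ℋ)) (u⁺ (i : ℋ)) :=
        hposs (u⁺ (i : ℋ)) (i : ℋ)
      exact inner_self_eq_zero.mp (h1 ▸ h0)
  unfold posTrace
  rw [posTraceOn_eq _ b hpos, posTraceOn_eq _ b hv]
  unfold posTraceOn
  refine ENNReal.tsum_le_tsum fun i => ENNReal.ofReal_le_ofReal ?_
  rw [hb]
  rcases hdich i with hi | hi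
  · have hui : u (i : ℋ) = u⁺ (i : ℋ) := by
      have := congrArg (fun T : ℋ →L[ℂ] ℋ => T (i : ℋ)) (CFC.posPart_sub_negPart u hu)
      simp only [sub_apply, hnegK _ hi, sub_zero] at this
      exact this.symm
    have h := inner_re_nonneg (sub_nonneg.mpr huv) (i : ℋ)
    rw [sub_apply, inner_sub_right, Complex.sub_re, hui] at h
    linarith
  · rw [hi, inner_zero_right]
    exact inner_re_nonneg hv _

lemma posTrace_abs {u : ℋ →L[ℂ] ℋ} (hu : IsSelfAdjoint u) :
    posTrace (CFC.abs u) = posTrace u⁺ + posTrace u⁻ := by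
  rw [← posTrace_add (CFC.posPart_nonneg u) (CFC.negPart_nonneg u),
    CFC.posPart_add_negPart u hu]

lemma posTrace_abs_add_le {u v : ℋ →L[ℂ] ℋ} (hu : IsSelfAdjoint u) (hv : IsSelfAdjoint v) :
    posTrace (CFC.abs (u + v)) ≤ posTrace (CFC.abs u) + posTrace (CFC.abs v) := by
  have key : ∀ {a b : ℋ →L[ℂ] ℋ}, IsSelfAdjoint a → IsSelfAdjoint b →
      posTrace (a + b)⁺ ≤ posTrace a⁺ + posTrace b⁺ := by
    intro a b ha hb
    rw [← posTrace_add (CFC.posPart_nonneg a) (CFC.posPart_nonneg b)]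
    exact posTrace_posPart_le (ha.add hb)
      (add_nonneg (CFC.posPart_nonneg a) (CFC.posPart_nonneg b))
      (add_le_add (CFC.le_posPart ha) (CFC.le_posPart hb))
  have h1 := key hu hv
  have h2 := key hu.neg hv.neg
  rw [← neg_add, CFC.posPart_neg, CFC.posPart_neg, CFC.posPart_neg] at h2
  rw [posTrace_abs (hu.add hv), posTrace_abs hu, posTrace_abs hv]
  calc _ ≤ (posTrace u⁺ + posTrace v⁺) + (posTrace u⁻ + posTrace v⁻) := add_le_add h1 h2
    _ = _ := by ring

lemma posTrace_smul {r : ℝ} (hr : 0 ≤ r) (A : ℋ →L[ℂ] ℋ) :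
    posTrace (r • A) = ENNReal.ofReal r * posTrace A := by
  unfold posTrace posTraceOn
  rw [← ENNReal.tsum_mul_left]
  congr 1; funext i
  rw [← ENNReal.ofReal_mul hr]
  congr 1
  rw [smul_apply, ← Complex.coe_smul, inner_smul_right, Complex.re_ofReal_mul]

lemma posTrace_abs_smul (r : ℝ) (u : ℋ →L[ℂ] ℋ) :
    posTrace (CFC.abs (r • u)) = ENNReal.ofReal |r| * posTrace (CFC.abs u) := by
  rw [CFC.abs_smul r u, Real.norm_eq_abs, posTrace_smul (abs_nonneg r)]

lemma eq_zero_of_posTrace_abs {u : ℋ →L[ℂ] ℋ} (h : posTrace (CFC.abs u) = 0) : u = 0 := by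
  have h1 := CFC.abs_nonneg u
  have hz : CFC.sqrt (CFC.abs u) = 0 := by
    have hi : ∀ i, CFC.sqrt (CFC.abs u) (stdBasis ℋ i) = 0 := by
      intro i
      have := ENNReal.tsum_eq_zero.mp h i
      rw [inner_eq_norm_sqrt h1, ENNReal.ofReal_eq_zero] at this
      have h2 : ‖CFC.sqrt (CFC.abs u) (stdBasis ℋ i)‖ ^ 2 = 0 := le_antisymm this (by positivity)
      simpa using h2
    ext x
    have hx := ((stdBasis ℋ).hasSum_repr x).mapL (CFC.sqrt (CFC.abs u))
    simp only [map_smul, hi, smul_zero] at hx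
    exact hx.unique hasSum_zero
  rw [CFC.sqrt_eq_zero_iff _ h1] at hz
  exact CFC.abs_eq_zero_iff.mp hz

variable (ℋ) in
/-- The real vector space of self-adjoint trace-class operators, as a subspace of the bounded
operators. -/
def traceClassSubmodule : Submodule ℝ (ℋ →L[ℂ] ℋ) where
  carrier := {u | IsSelfAdjoint u ∧ IsTraceClass u}
  zero_mem' := ⟨IsSelfAdjoint.zero _, by simp [IsTraceClass, posTrace, posTraceOn]⟩
  add_mem' := fun {u v} hu hv => ⟨hu.1.add hv.1,
    (posTrace_abs_add_le hu.1 hv.1).trans_lt (ENNReal.add_lt_top.mpr ⟨hu.2, hv.2⟩)⟩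
  smul_mem' := fun r u hu => ⟨(IsSelfAdjoint.all r).smul hu.1, by
    show posTrace _ < ∞
    rw [posTrace_abs_smul]
    exact ENNReal.mul_lt_top ENNReal.ofReal_lt_top hu.2⟩

variable (ℋ) in
/-- The space `𝒞₁ˢᵃ` of self-adjoint trace-class operators. It is a type of its own, so that it
carries the trace norm and not the operator norm. -/
def TraceClassSA : Type _ := traceClassSubmodule ℋ

namespace TraceClassSA

instance : AddCommGroup (TraceClassSA ℋ) := inferInstanceAs (AddCommGroup (traceClassSubmodule ℋ))

instance : Module ℝ (TraceClassSA ℋ) := inferInstanceAs (Module ℝ (traceClassSubmodule ℋ))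

/-- The underlying bounded operator. -/
def toOp (u : TraceClassSA ℋ) : ℋ →L[ℂ] ℋ := u.1

/-- The order of operators: `u ≤ v` if `v - u` is a positive operator. -/
instance : PartialOrder (TraceClassSA ℋ) := PartialOrder.lift toOp Subtype.val_injective

open scoped ComplexOrder in
lemma le_iff (u v : TraceClassSA ℋ) : u ≤ v ↔ ∀ x : ℋ, 0 ≤ inner ℂ ((v.toOp - u.toOp) x) x := by
  show u.toOp ≤ v.toOp ↔ _
  rw [ContinuousLinearMap.le_def, ContinuousLinearMap.isPositive_iff_complex]
  refine forall_congr' fun x => ?_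
  rw [Complex.nonneg_iff, Complex.ext_iff]
  simp only [RCLike.re_to_complex, Complex.ofReal_re, Complex.ofReal_im, true_and]
  tauto

/-- The trace norm `‖u‖ = Tr |u|`. -/
instance : NormedAddCommGroup (TraceClassSA ℋ) :=
  AddGroupNorm.toNormedAddCommGroup
    { toFun := fun u => (posTrace (CFC.abs u.toOp)).toReal
      map_zero' := by
        show (posTrace (CFC.abs (0 : ℋ →L[ℂ] ℋ))).toReal = 0
        simp [posTrace, posTraceOn]
      add_le' := fun u v => by
        have h := ENNReal.toReal_mono (ENNReal.add_lt_top.mpr ⟨u.2.2, v.2.2⟩).ne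
          (posTrace_abs_add_le u.2.1 v.2.1)
        rwa [ENNReal.toReal_add u.2.2.ne v.2.2.ne] at h
      neg' := fun u => by
        show (posTrace (CFC.abs (-u.toOp))).toReal = _
        rw [CFC.abs_neg]
      eq_zero_of_map_eq_zero' := fun u hu =>
        Subtype.ext (eq_zero_of_posTrace_abs
          (((ENNReal.toReal_eq_zero_iff _).mp hu).resolve_right u.2.2.ne)) }

lemma norm_def (u : TraceClassSA ℋ) : ‖u‖ = (posTrace (CFC.abs u.toOp)).toReal := rfl

instance : NormedSpace ℝ (TraceClassSA ℋ) where
  norm_smul_le r u := by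
    show (posTrace (CFC.abs (r • u.toOp))).toReal ≤ _
    rw [posTrace_abs_smul, ENNReal.toReal_mul, ENNReal.toReal_ofReal (abs_nonneg r)]
    rfl

/-- The trace `Tr u = ∑ᵢ (u eᵢ, eᵢ)`. -/
def tr (u : TraceClassSA ℋ) : ℝ := ∑' i, (inner ℂ (stdBasis ℋ i) (u.toOp (stdBasis ℋ i))).re

lemma hasSum_posTrace {ι : Type*} (e : HilbertBasis ι ℂ ℋ) {A : ℋ →L[ℂ] ℋ} (hA : 0 ≤ A)
    (h : posTrace A < ∞) : HasSum (fun i => (inner ℂ (e i) (A (e i))).re) (posTrace A).toReal := by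
  unfold posTrace at h ⊢
  rw [posTraceOn_eq _ e hA] at h ⊢
  unfold posTraceOn at h ⊢
  rw [ENNReal.tsum_toReal_eq (fun _ => ENNReal.ofReal_ne_top)]
  simpa only [ENNReal.toReal_ofReal (inner_re_nonneg hA _),
    ENNReal.tsum_toReal_eq (fun _ => ENNReal.ofReal_ne_top)] using ENNReal.hasSum_toReal h.ne

lemma hasSum_sub {ι : Type*} (e : HilbertBasis ι ℂ ℋ) (u : TraceClassSA ℋ) :
    HasSum (fun i => (inner ℂ (e i) (u.toOp (e i))).re)
      ((posTrace u.toOp⁺).toReal - (posTrace u.toOp⁻).toReal) := by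
  have hsa : IsSelfAdjoint u.toOp := u.2.1
  have hfin : posTrace (CFC.abs u.toOp) < ∞ := u.2.2
  rw [posTrace_abs hsa, ENNReal.add_lt_top] at hfin
  have h := (hasSum_posTrace e (CFC.posPart_nonneg u.toOp) hfin.1).sub
    (hasSum_posTrace e (CFC.negPart_nonneg u.toOp) hfin.2)
  have heq : (fun i => (inner ℂ (e i) (u.toOp (e i))).re) = fun i =>
      (inner ℂ (e i) (u.toOp⁺ (e i))).re - (inner ℂ (e i) (u.toOp⁻ (e i))).re := by
    funext i
    rw [← Complex.sub_re, ← inner_sub_right, ← sub_apply, CFC.posPart_sub_negPart u.toOp hsa]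
  rw [heq]
  exact h

/-- The series of the trace converges, and to the same value in every Hilbert basis. -/
lemma hasSum_tr {ι : Type*} (e : HilbertBasis ι ℂ ℋ) (u : TraceClassSA ℋ) :
    HasSum (fun i => (inner ℂ (e i) (u.toOp (e i))).re) u.tr := by
  have h : u.tr = _ := (hasSum_sub (stdBasis ℋ) u).tsum_eq
  rw [h]
  exact hasSum_sub e u

lemma norm_eq_tr (u : TraceClassSA ℋ) (hu : 0 ≤ u) : ‖u‖ = u.tr := by
  have hu' : (0 : ℋ →L[ℂ] ℋ) ≤ u.toOp := hu
  have h : posTrace (CFC.abs u.toOp) < ∞ := u.2.2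
  rw [norm_def, CFC.abs_of_nonneg _ hu'] at *
  exact (hasSum_posTrace (stdBasis ℋ) hu' h).unique (hasSum_tr _ u)

end TraceClassSA

end TraceClass

/-! ### `C₀`-semigroups and their generators -/

section Semigroup

variable {X : Type*} [NormedAddCommGroup X] [NormedSpace ℝ X]

/-- `T` is a `C₀`-semigroup of bounded operators (with the convention `T₀ = I`). -/
structure IsC0Semigroup (T : ℝ≥0 → X →L[ℝ] X) : Prop where
  map_zero : T 0 = ContinuousLinearMap.id ℝ X
  map_add : ∀ s t : ℝ≥0, T (s + t) = (T s).comp (T t)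
  tendsto_zero : ∀ u : X, Tendsto (fun t : ℝ≥0 => T t u) (𝓝[>] 0) (𝓝 u)

/-- `y` is the right derivative at `t = 0` of `t ↦ T t u`. -/
def IsOrbitDeriv (T : ℝ≥0 → X →L[ℝ] X) (u y : X) : Prop :=
  Tendsto (fun t : ℝ≥0 => (t : ℝ)⁻¹ • (T t u - u)) (𝓝[>] 0) (𝓝 y)

lemma IsOrbitDeriv.add {T : ℝ≥0 → X →L[ℝ] X} {u v y z : X} (h : IsOrbitDeriv T u y)
    (h' : IsOrbitDeriv T v z) : IsOrbitDeriv T (u + v) (y + z) := by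
  refine (Tendsto.add h h').congr fun t => ?_
  rw [map_add, ← smul_add]
  congr 1
  abel

lemma IsOrbitDeriv.smul {T : ℝ≥0 → X →L[ℝ] X} {u y : X} (c : ℝ) (h : IsOrbitDeriv T u y) :
    IsOrbitDeriv T (c • u) (c • y) := by
  refine (Tendsto.const_smul h c).congr fun t => ?_
  rw [map_smul, ← smul_sub, smul_comm]

lemma IsOrbitDeriv.unique {T : ℝ≥0 → X →L[ℝ] X} {u y z : X} (h : IsOrbitDeriv T u y)
    (h' : IsOrbitDeriv T u z) : y = z :=
  tendsto_nhds_unique h h'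

/-- The generator `A u = lim_{t ↓ 0} (T t u - u) / t` of `T`, with domain all `u` for which the
limit exists. -/
def generator (T : ℝ≥0 → X →L[ℝ] X) : X →ₗ.[ℝ] X where
  domain :=
    { carrier := {u | ∃ y, IsOrbitDeriv T u y}
      zero_mem' := ⟨0, by simp [IsOrbitDeriv]⟩
      add_mem' := fun ⟨y, hy⟩ ⟨z, hz⟩ => ⟨y + z, hy.add hz⟩
      smul_mem' := fun c _ ⟨y, hy⟩ => ⟨c • y, hy.smul c⟩ }
  toFun :=
    { toFun := fun u => u.2.choose
      map_add' := fun u v =>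
        (u + v).2.choose_spec.unique (u.2.choose_spec.add v.2.choose_spec)
      map_smul' := fun c u => (c • u).2.choose_spec.unique (u.2.choose_spec.smul c) }

lemma generator_spec (T : ℝ≥0 → X →L[ℝ] X) (u : (generator T).domain) :
    IsOrbitDeriv T u (generator T u) :=
  u.2.choose_spec

/-- The operator `H - K` with domain `D(H)`, for `K` defined on `D(H)`. -/
def subOp (H : X →ₗ.[ℝ] X) (K : H.domain →ₗ[ℝ] X) : X →ₗ.[ℝ] X where
  domain := H.domain
  toFun := H.toFun - K

end Semigroup

/-! ### Dynamical semigroups and functional regularisations -/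

section Dynamical

variable {ℋ : Type*} [NormedAddCommGroup ℋ] [InnerProductSpace ℂ ℋ] [CompleteSpace ℋ]

/-- An operator `A : D → 𝒞₁ˢᵃ` is positivity preserving if `A u ≥ 0` for all `u ∈ D` with
`u ≥ 0`. -/
def PositivityPreserving {D : Submodule ℝ (TraceClassSA ℋ)} (A : D →ₗ[ℝ] TraceClassSA ℋ) : Prop :=
  ∀ u : D, 0 ≤ (u : TraceClassSA ℋ) → 0 ≤ A u

/-- A dynamical semigroup: a positivity preserving contraction `C₀`-semigroup on `𝒞₁ˢᵃ`. -/
structure IsDynamicalSemigroup (T : ℝ≥0 → TraceClassSA ℋ →L[ℝ] TraceClassSA ℋ) : Prop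
    extends IsC0Semigroup T where
  contraction : ∀ t, ‖T t‖ ≤ 1
  positivity : ∀ t u, 0 ≤ u → 0 ≤ T t u

/-- A Markov dynamical semigroup: a trace preserving dynamical semigroup. -/
structure IsMarkovDynamicalSemigroup (T : ℝ≥0 → TraceClassSA ℋ →L[ℝ] TraceClassSA ℋ) : Prop
    extends IsDynamicalSemigroup T where
  trace_preserving : ∀ t u, (T t u).tr = u.tr

/-- The net `(Kα)` of operators on `D(H)` is a functional regularisation of `K`. -/
structure IsFunctionalRegularisation {J : Type*} [Preorder J]
    (H : TraceClassSA ℋ →ₗ.[ℝ] TraceClassSA ℋ) (K : H.domain →ₗ[ℝ] TraceClassSA ℋ)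
    (Kα : J → H.domain →ₗ[ℝ] TraceClassSA ℋ) : Prop where
  positivity : ∀ α, PositivityPreserving (Kα α)
  trace_bound : ∀ α, ∃ a b : ℝ, 0 ≤ a ∧ 0 ≤ b ∧ b < 1 ∧
    ∀ u : H.domain, 0 ≤ (u : TraceClassSA ℋ) →
      (Kα α u).tr ≤ a * (u : TraceClassSA ℋ).tr + b * (H u).tr
  mono : ∀ α β, α ≤ β → PositivityPreserving (Kα β - Kα α)
  le : ∀ α, PositivityPreserving (K - Kα α)
  tendsto : ∀ u : H.domain, 0 ≤ (u : TraceClassSA ℋ) →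
    ∃ V : Submodule ℂ ℋ, Dense (V : Set ℋ) ∧
      ∀ x ∈ V, Tendsto (fun α => inner ℂ ((Kα α u).toOp x) x) atTop (𝓝 (inner ℂ ((K u).toOp x) x))

/-- `T` is the semigroup constructed from `H` and the net `(Kα)`: for each `α` the operator
`-(H - Kα)` generates a `C₀`-semigroup `Tα`, and `T t u = lim_α Tα t u` in trace norm. -/
def IsRegularisedSemigroup {J : Type*} [Preorder J]
    (H : TraceClassSA ℋ →ₗ.[ℝ] TraceClassSA ℋ) (Kα : J → H.domain →ₗ[ℝ] TraceClassSA ℋ)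
    (T : ℝ≥0 → TraceClassSA ℋ →L[ℝ] TraceClassSA ℋ) : Prop :=
  ∃ Tα : J → ℝ≥0 → TraceClassSA ℋ →L[ℝ] TraceClassSA ℋ,
    (∀ α, IsC0Semigroup (Tα α) ∧ generator (Tα α) = -subOp H (Kα α)) ∧
    ∀ t u, Tendsto (fun α => Tα α t u) atTop (𝓝 (T t u))

end Dynamical

end KatoReg

end

noncomputable section

namespace KatoReg

/-! ### Strongly continuous semigroups: local bounds, orbits, generators and limits. -/

section C0Semigroup

open Set

variable {X : Type*} [NormedAddCommGroup X] [NormedSpace ℝ X] {T U : ℝ≥0 → X →L[ℝ] X}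

/-! On the positive cone the trace norm is the trace, and every element is a difference of positive
ones whose norms add up. Norm estimates thus become trace inequalities on positive elements.

For large `l` the operator `G = K_α (l + H)⁻¹` is positive with norm less than one, because `l Tr Rx
+ Tr HRx = Tr x` for `R = (l + H)⁻¹`. The Neumann series gives the positive resolvent `R ∑ Gⁿ` of
`-(H - K_α)`, and `Tr K_α ≤ Tr H` makes `l` times it a contraction (`exists_isResolvent_subOp`).
Hille–Yosida then yields a dynamical semigroup `T^α`. Resolvents increase with the perturbation,
hence so do the Yosida approximants and the semigroups. For `u ≥ 0` the net `T^α_t u` is therefore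
increasing with traces at most `Tr u`, and such nets converge in trace norm
(`exists_tendsto_of_monotone`).

Strong continuity of the limit needs a modulus independent of `α`. Since `S_t ≤ T^α_t` and `T^α`
does not increase the trace, `‖T^α_t u - u‖ ≤ 2 ‖S_t u - u‖` for `u ≥ 0`. As `K_α u → K u` in trace
norm, the same modulus shows that the generator of `T` extends `-(H - K)`
(`isDynamicalSemigroup_of_tendsto`).

The trace is continuous and vanishes on `(H - K) D(H)`. If `D(H)` is a core, it vanishes on the
range of the generator, so `Tr T_t u` has zero derivative for `u` in the domain; density does the
rest (`isMarkov_of_hasCore`). -/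

lemma tendsto_sub_toNNReal (s : ℝ) :
    Tendsto (fun y : ℝ => (y - s).toNNReal) (𝓝[>] s) (𝓝[>] (0 : ℝ≥0)) := by
  refine tendsto_nhdsWithin_iff.mpr ⟨?_, ?_⟩
  · have h : Continuous fun y : ℝ => (y - s).toNNReal := by fun_prop
    have h' := h.tendsto s
    simp only [sub_self, Real.toNNReal_zero] at h'
    exact h'.mono_left nhdsWithin_le_nhds
  · filter_upwards [self_mem_nhdsWithin] with y hy
    exact Real.toNNReal_pos.mpr (sub_pos.mpr hy)

lemma tendsto_coe_nhdsNE_zero : Tendsto ((↑) : ℝ≥0 → ℝ) (𝓝[>] 0) (𝓝[≠] 0) := by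
  refine tendsto_nhdsWithin_iff.mpr ⟨?_, ?_⟩
  · exact (NNReal.continuous_coe.tendsto 0).mono_left nhdsWithin_le_nhds
  · filter_upwards [self_mem_nhdsWithin] with t ht
    exact (NNReal.coe_pos.mpr ht).ne'

lemma IsC0Semigroup.tendsto_nhds_zero (hT : IsC0Semigroup T) (u : X) :
    Tendsto (fun t : ℝ≥0 => T t u) (𝓝 0) (𝓝 u) := by
  rw [← bot_eq_zero, ← nhdsWithin_univ, ← Ici_bot, ← Ioi_insert, nhdsWithin_insert, bot_eq_zero,
    tendsto_sup]
  refine ⟨?_, hT.tendsto_zero u⟩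
  rw [tendsto_pure_left]
  intro s hs
  rw [hT.map_zero]
  exact mem_of_mem_nhds hs

/-- Otherwise there are `t n → 0` with `‖T (t n)‖ > n`, although `T (t n) u → u` for every `u`; this
contradicts uniform boundedness. -/
lemma IsC0Semigroup.exists_bound_near_zero [CompleteSpace X] (hT : IsC0Semigroup T) :
    ∃ δ : ℝ≥0, 0 < δ ∧ ∃ M : ℝ, ∀ t ≤ δ, ‖T t‖ ≤ M := by
  by_contra! hcon
  have hpos : ∀ n : ℕ, (0 : ℝ≥0) < 1 / ((n : ℝ≥0) + 1) := fun n => by positivity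
  choose t ht hM using fun n : ℕ => hcon (1 / ((n : ℝ≥0) + 1)) (hpos n) n
  have ht0 : Tendsto t atTop (𝓝 0) :=
    tendsto_of_tendsto_of_tendsto_of_le_of_le tendsto_const_nhds
      tendsto_one_div_add_atTop_nhds_zero_nat (fun n => zero_le) ht
  obtain ⟨C, hC⟩ := banach_steinhaus (g := fun n => T (t n)) fun x => by
    have h := ((hT.tendsto_nhds_zero x).comp ht0).norm
    obtain ⟨C, hC⟩ := h.bddAbove_range
    exact ⟨C, fun i => hC ⟨i, rfl⟩⟩
  obtain ⟨n, hn⟩ := exists_nat_gt C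
  linarith [hM n, hC n]

/-- The norms of a `C₀`-semigroup are locally bounded. -/
lemma IsC0Semigroup.exists_bound [CompleteSpace X] (hT : IsC0Semigroup T) (b : ℝ≥0) :
    ∃ M : ℝ, ∀ t ≤ b, ‖T t‖ ≤ M := by
  obtain ⟨δ, hδ, M, hM⟩ := hT.exists_bound_near_zero
  have hM0 : 0 ≤ M := (norm_nonneg _).trans (hM 0 zero_le)
  have key : ∀ n : ℕ, ∃ M' : ℝ, ∀ t ≤ n * δ, ‖T t‖ ≤ M' := by
    intro n
    induction n with
    | zero => exact ⟨M, fun t ht => hM t (ht.trans (by simp))⟩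
    | succ n ih =>
      obtain ⟨M', hM'⟩ := ih
      have hM'0 : 0 ≤ M' := (norm_nonneg _).trans (hM' 0 zero_le)
      refine ⟨max M (M * M'), fun t ht => ?_⟩
      rcases le_total t δ with h | h
      · exact (hM t h).trans (le_max_left _ _)
      · have h1 : T t = (T δ).comp (T (t - δ)) := by
          rw [← hT.map_add, add_tsub_cancel_of_le h]
        rw [h1]
        refine ((ContinuousLinearMap.opNorm_comp_le _ _).trans ?_).trans (le_max_right _ _)
        refine mul_le_mul (hM δ le_rfl) (hM' _ ?_) (norm_nonneg _) hM0
        rw [tsub_le_iff_right]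
        refine ht.trans_eq ?_
        push_cast
        ring
  obtain ⟨n, hn⟩ := exists_nat_gt (b / δ)
  obtain ⟨M', hM'⟩ := key n
  refine ⟨M', fun t ht => hM' t (ht.trans ?_)⟩
  exact ((div_lt_iff₀ hδ).mp hn).le

/-- With `a ≤ b` one has `T b u - T a u = T a (T (b - a) u - u)`, so local boundedness reduces both
one-sided limits to continuity at zero. -/
lemma IsC0Semigroup.continuous [CompleteSpace X] (hT : IsC0Semigroup T) (u : X) :
    Continuous fun t : ℝ≥0 => T t u := by
  rw [continuous_iff_continuousAt]
  intro t
  obtain ⟨M, hM⟩ := hT.exists_bound (t + 1)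
  have hbound : ∀ᶠ s in 𝓝 t, ‖T s u - T t u‖ ≤ M * ‖T (max s t - min s t) u - u‖ := by
    filter_upwards [Iic_mem_nhds (show t < t + 1 by simp)] with s hs
    have key : ∀ a b : ℝ≥0, a ≤ b → b ≤ t + 1 → ‖T b u - T a u‖ ≤ M * ‖T (b - a) u - u‖ := by
      intro a b hab hb
      have h1 : T b u = T a (T (b - a) u) := by
        rw [← ContinuousLinearMap.comp_apply, ← hT.map_add, add_tsub_cancel_of_le hab]
      rw [h1, ← map_sub]
      exact ((T a).le_opNorm _).trans
        (mul_le_mul_of_nonneg_right (hM a (hab.trans hb)) (norm_nonneg _))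
    rcases le_total s t with h | h
    · rw [max_eq_right h, min_eq_left h, norm_sub_rev]
      exact key s t h (by simp)
    · rw [max_eq_left h, min_eq_right h]
      exact key t s h hs
  have hlim : Tendsto (fun s : ℝ≥0 => M * ‖T (max s t - min s t) u - u‖) (𝓝 t) (𝓝 0) := by
    have h1 : Tendsto (fun s : ℝ≥0 => max s t - min s t) (𝓝 t) (𝓝 0) := by
      have : Continuous fun s : ℝ≥0 => max s t - min s t := by fun_prop
      simpa using this.tendsto t
    have h2 := ((hT.tendsto_nhds_zero u).comp h1).sub_const u
    simpa using h2.norm.const_mul M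
  exact tendsto_iff_norm_sub_tendsto_zero.mpr
    (squeeze_zero' (Eventually.of_forall fun _ => norm_nonneg _) hbound hlim)

lemma IsC0Semigroup.tendsto_apply [CompleteSpace X] (hT : IsC0Semigroup T) {ι : Type*}
    {l : Filter ι} {r : ι → ℝ≥0} {r₀ : ℝ≥0} {g : ι → X} {g₀ : X} (hr : Tendsto r l (𝓝 r₀))
    (hg : Tendsto g l (𝓝 g₀)) : Tendsto (fun i => T (r i) (g i)) l (𝓝 (T r₀ g₀)) := by
  obtain ⟨M, hM⟩ := hT.exists_bound (r₀ + 1)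
  have h1 : Tendsto (fun i => T (r i) g₀) l (𝓝 (T r₀ g₀)) :=
    ((hT.continuous g₀).tendsto r₀).comp hr
  have h2 : Tendsto (fun i => T (r i) (g i - g₀)) l (𝓝 0) := by
    refine squeeze_zero_norm' (a := fun i => M * ‖g i - g₀‖) ?_ ?_
    · filter_upwards [hr.eventually (Iic_mem_nhds (show r₀ < r₀ + 1 by simp))] with i hi
      exact ((T (r i)).le_opNorm _).trans (mul_le_mul_of_nonneg_right (hM _ hi) (norm_nonneg _))
    · simpa using (hg.sub_const g₀).norm.const_mul M
  refine (by simpa using h2.add h1 : Tendsto _ l _).congr fun i => ?_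
  simp

lemma IsOrbitDeriv.apply (hT : IsC0Semigroup T) {u y : X} (h : IsOrbitDeriv T u y) (s : ℝ≥0) :
    IsOrbitDeriv T (T s u) (T s y) := by
  refine (((T s).continuous.tendsto y).comp h).congr fun t => ?_
  have : T t (T s u) = T s (T t u) := by
    rw [← ContinuousLinearMap.comp_apply, ← ContinuousLinearMap.comp_apply, ← hT.map_add,
      ← hT.map_add, add_comm]
  simp [this]

/-- Time is moved to `ℝ` so that the mean value inequalities for right derivatives apply. -/
lemma IsOrbitDeriv.hasDerivWithinAt (hT : IsC0Semigroup T) {u y : X} (h : IsOrbitDeriv T u y)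
    {s : ℝ} (hs : 0 ≤ s) :
    HasDerivWithinAt (fun r : ℝ => T r.toNNReal u) (T s.toNNReal y) (Ici s) s := by
  rw [← hasDerivWithinAt_Ioi_iff_Ici, hasDerivWithinAt_iff_tendsto_slope' (by simp)]
  refine Tendsto.congr' ?_ ((h.apply hT s.toNNReal).comp (tendsto_sub_toNNReal s))
  filter_upwards [self_mem_nhdsWithin] with r hr
  have hr' : 0 ≤ r - s := (sub_pos.mpr hr).le
  simp only [Function.comp_apply, slope_def_module, Real.coe_toNNReal _ hr']
  rw [← ContinuousLinearMap.comp_apply, ← hT.map_add, ← Real.toNNReal_add hr' hs, sub_add_cancel]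

/-- Two orbits with the same starting point are compared through `s ↦ T (t - s) (U s u)`. -/
lemma IsC0Semigroup.norm_sub_le [CompleteSpace X] (hT : IsC0Semigroup T) (hU : IsC0Semigroup U)
    {u : X} {a b : ℝ≥0 → X} (ha : ∀ s, IsOrbitDeriv T (U s u) (a s))
    (hb : ∀ s, IsOrbitDeriv U (U s u) (b s)) {t : ℝ≥0} {C : ℝ}
    (hC : ∀ r s, r ≤ t → s ≤ t → ‖T r (b s - a s)‖ ≤ C) : ‖U t u - T t u‖ ≤ C * t := by
  have hcont : ContinuousOn (fun s : ℝ => T ((t : ℝ) - s).toNNReal (U s.toNNReal u))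
      (Icc 0 (t : ℝ)) := by
    refine Continuous.continuousOn (continuous_iff_continuousAt.mpr fun s => ?_)
    refine hT.tendsto_apply ?_ ?_
    · have : Continuous fun s : ℝ => ((t : ℝ) - s).toNNReal := by fun_prop
      exact this.tendsto s
    · exact ((hU.continuous u).comp continuous_real_toNNReal).tendsto s
  have hderiv : ∀ s ∈ Ico 0 (t : ℝ),
      HasDerivWithinAt (fun s : ℝ => T ((t : ℝ) - s).toNNReal (U s.toNNReal u))
        (T ((t : ℝ) - s).toNNReal (b s.toNNReal - a s.toNNReal)) (Ici s) s := by
    intro s hs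
    rw [← hasDerivWithinAt_Ioi_iff_Ici, hasDerivWithinAt_iff_tendsto_slope' (by simp)]
    have h1 := ((hb s.toNNReal).sub (ha s.toNNReal)).comp (tendsto_sub_toNNReal s)
    have h2 : Tendsto (fun r : ℝ => ((t : ℝ) - r).toNNReal) (𝓝[>] s)
        (𝓝 ((t : ℝ) - s).toNNReal) := by
      have : Continuous fun r : ℝ => ((t : ℝ) - r).toNNReal := by fun_prop
      exact (this.tendsto s).mono_left nhdsWithin_le_nhds
    refine Tendsto.congr' ?_ (hT.tendsto_apply h2 h1)
    filter_upwards [self_mem_nhdsWithin, Ioo_mem_nhdsGT hs.2] with r hr hr2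
    have hr' : 0 ≤ r - s := (sub_pos.mpr hr).le
    have hU' : U r.toNNReal u = U (r - s).toNNReal (U s.toNNReal u) := by
      rw [← ContinuousLinearMap.comp_apply, ← hU.map_add, ← Real.toNNReal_add hr' hs.1,
        sub_add_cancel]
    have hT' : ∀ v, T ((t : ℝ) - s).toNNReal v =
        T ((t : ℝ) - r).toNNReal (T (r - s).toNNReal v) := by
      intro v
      rw [← ContinuousLinearMap.comp_apply, ← hT.map_add,
        ← Real.toNNReal_add (sub_nonneg.mpr hr2.2.le) hr', sub_add_sub_cancel]
    simp only [Function.comp_apply, slope_def_module, Real.coe_toNNReal _ hr']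
    -- Both terms of the difference quotient factor through `T (t - r)`, which leaves the difference
    -- of the two quotients of `U` and `T` at the point `U s u`.
    rw [hU', hT', ← smul_sub, map_smul, ← map_sub]
    congr 2
    abel
  have h := norm_image_sub_le_of_norm_deriv_right_le_segment hcont hderiv (C := C) (fun s hs =>
    hC _ _ (Real.toNNReal_le_iff_le_coe.mpr (by linarith [hs.1]))
      (Real.toNNReal_le_iff_le_coe.mpr hs.2.le)) t ⟨t.2, le_rfl⟩
  simpa [hT.map_zero, hU.map_zero] using h

lemma mem_generator_domain {u y : X} (h : IsOrbitDeriv T u y) : u ∈ (generator T).domain := ⟨y, h⟩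

lemma generator_apply {u y : X} (h : IsOrbitDeriv T u y) (hu : u ∈ (generator T).domain) :
    generator T ⟨u, hu⟩ = y :=
  (generator_spec T ⟨u, hu⟩).unique h

lemma isOrbitDeriv_iff {u y : X} :
    IsOrbitDeriv T u y ↔ ∃ h : u ∈ (generator T).domain, generator T ⟨u, h⟩ = y :=
  ⟨fun h => ⟨⟨y, h⟩, generator_apply h _⟩, fun ⟨h, e⟩ => e ▸ generator_spec T ⟨u, h⟩⟩

lemma isOrbitDeriv_congr (h : generator T = generator U) {u y : X} :
    IsOrbitDeriv T u y ↔ IsOrbitDeriv U u y := by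
  rw [isOrbitDeriv_iff, isOrbitDeriv_iff, h]

/-- A `C₀`-semigroup is determined by its generator, if this is densely defined. -/
lemma IsC0Semigroup.eq_of_generator_eq [CompleteSpace X] (hT : IsC0Semigroup T)
    (hU : IsC0Semigroup U) (h : generator T = generator U)
    (hd : Dense ((generator T).domain : Set X)) : T = U := by
  funext t
  refine ContinuousLinearMap.ext fun x => ?_
  have : EqOn (T t) (U t) ((generator T).domain : Set X) := by
    rintro u ⟨y, hy⟩
    have hy' := (isOrbitDeriv_congr h).mp hy
    have h0 := hT.norm_sub_le hU (u := u) (a := fun s => U s y) (b := fun s => U s y)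
      (fun s => (isOrbitDeriv_congr h).mpr (hy'.apply hU s)) (fun s => hy'.apply hU s)
      (t := t) (C := 0) (by simp)
    rw [zero_mul, norm_le_zero_iff, sub_eq_zero] at h0
    exact h0.symm
  exact congrFun ((T t).continuous.ext_on hd (U t).continuous this) x

/-- The generator of a contraction semigroup is dissipative. -/
lemma IsOrbitDeriv.dissipative (hc : ∀ t, ‖T t‖ ≤ 1) {u y : X} (h : IsOrbitDeriv T u y) (l : ℝ) :
    l * ‖u‖ ≤ ‖l • u - y‖ := by
  refine ge_of_tendsto (h.const_sub (l • u)).norm ?_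
  filter_upwards [self_mem_nhdsWithin] with t ht
  have ht' : (0 : ℝ) < t := ht
  -- The difference quotient is split so that contractivity bounds the second term by `t⁻¹ ‖u‖`.
  have h1 : l • u - (t : ℝ)⁻¹ • (T t u - u) = (l + (t : ℝ)⁻¹) • u - (t : ℝ)⁻¹ • T t u := by
    module
  have h2 : ‖T t u‖ ≤ ‖u‖ := by simpa using (T t).le_of_opNorm_le (hc t) u
  have h4 : ‖(t : ℝ)⁻¹ • T t u‖ ≤ (t : ℝ)⁻¹ * ‖u‖ := by
    rw [norm_smul, Real.norm_of_nonneg (by positivity)]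
    gcongr
  have h5 : (l + (t : ℝ)⁻¹) * ‖u‖ ≤ ‖(l + (t : ℝ)⁻¹) • u‖ := by
    rw [norm_smul]
    gcongr
    exact le_abs_self _
  rw [h1]
  have h3 := norm_sub_norm_le ((l + (t : ℝ)⁻¹) • u) ((t : ℝ)⁻¹ • T t u)
  linarith

/-- The left side is the norm of the integral of `T s z - y` over `[0, t]`. The vector `y` may
differ from the derivative `z`, which allows comparison with a limit of derivatives. -/
lemma IsC0Semigroup.norm_sub_sub_le [CompleteSpace X] (hT : IsC0Semigroup T) {u y z : X}
    (h : IsOrbitDeriv T u z) {t : ℝ≥0} {C : ℝ} (hC : ∀ s ≤ t, ‖T s z - y‖ ≤ C) :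
    ‖T t u - u - (t : ℝ) • y‖ ≤ C * t := by
  have hcont : ContinuousOn (fun s : ℝ => T s.toNNReal u - s • y) (Icc 0 (t : ℝ)) :=
    (((hT.continuous u).comp continuous_real_toNNReal).sub (by fun_prop)).continuousOn
  have h1 := norm_image_sub_le_of_norm_deriv_right_le_segment hcont
    (f' := fun s => T s.toNNReal z - y) (fun s hs => ?_) (C := C) (fun s hs =>
    hC _ (Real.toNNReal_le_iff_le_coe.mpr hs.2.le)) t ⟨t.2, le_rfl⟩
  · simp only [Real.toNNReal_coe, Real.toNNReal_zero, hT.map_zero, zero_smul, sub_zero,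
      ContinuousLinearMap.id_apply] at h1
    rwa [sub_right_comm]
  · have := (h.hasDerivWithinAt hT hs.1).sub ((hasDerivAt_id s).smul_const y).hasDerivWithinAt
    rw [one_smul] at this
    exact this

lemma IsC0Semigroup.norm_sub_self_le [CompleteSpace X] (hT : IsC0Semigroup T)
    (hc : ∀ t, ‖T t‖ ≤ 1) {u z : X} (h : IsOrbitDeriv T u z) (t : ℝ≥0) :
    ‖T t u - u‖ ≤ ‖z‖ * t := by
  have := hT.norm_sub_sub_le h (y := 0) (t := t) (C := ‖z‖) fun s _ => by
    simpa using (T s).le_of_opNorm_le (hc s) z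
  simpa using this

/-- The orbit derivatives of a net of contraction semigroups pass to the limit. -/
lemma isOrbitDeriv_of_tendsto [CompleteSpace X] {ι : Type*} {l : Filter ι} [l.NeBot]
    {V : ι → ℝ≥0 → X →L[ℝ] X} (hV : ∀ i, IsC0Semigroup (V i)) (hc : ∀ i t, ‖V i t‖ ≤ 1)
    (hlim : ∀ t x, Tendsto (fun i => V i t x) l (𝓝 (T t x))) {u y : X} {z : ι → X}
    (hz : ∀ᶠ i in l, IsOrbitDeriv (V i) u (z i)) (hzy : Tendsto z l (𝓝 y))
    {ω : ℝ≥0 → ℝ} (hω : Tendsto ω (𝓝 0) (𝓝 0)) (hy : ∀ i s, ‖V i s y - y‖ ≤ ω s) :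
    IsOrbitDeriv T u y := by
  rw [IsOrbitDeriv, Metric.tendsto_nhds]
  intro ε hε
  have hε2 : 0 < ε / 2 := half_pos hε
  have h1 : ∀ᶠ s in 𝓝 (0 : ℝ≥0), ω s < ε / 2 := hω.eventually_lt_const hε2
  obtain ⟨δ, hδ, hδ'⟩ := Metric.eventually_nhds_iff.mp h1
  have h2 : ∀ᶠ t in 𝓝[>] (0 : ℝ≥0), dist t 0 < δ :=
    nhdsWithin_le_nhds (Metric.ball_mem_nhds _ hδ)
  filter_upwards [self_mem_nhdsWithin, h2] with t ht htδ
  have ht' : (0 : ℝ) < t := ht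
  have h3 : ‖T t u - u - (t : ℝ) • y‖ ≤ ε / 2 * t := by
    have hl : Tendsto (fun i => ‖V i t u - u - (t : ℝ) • y‖) l
        (𝓝 ‖T t u - u - (t : ℝ) • y‖) :=
      (((hlim t u).sub_const u).sub_const _).norm
    have hr : Tendsto (fun i => (‖z i - y‖ + ε / 2) * t) l (𝓝 (ε / 2 * t)) := by
      have := ((hzy.sub_const y).norm.add_const (ε / 2)).mul_const (t : ℝ)
      simpa using this
    refine le_of_tendsto_of_tendsto hl hr ?_
    filter_upwards [hz] with i hi
    refine (hV i).norm_sub_sub_le hi fun s hs => ?_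
    -- Contractivity controls the first summand uniformly in `s`, the common modulus `ω` the second
    -- uniformly in `i`.
    have e : V i s (z i) - y = V i s (z i - y) + (V i s y - y) := by
      rw [map_sub]; abel
    rw [e]
    refine (norm_add_le _ _).trans (add_le_add ?_ ?_)
    · simpa using (V i s).le_of_opNorm_le (hc i s) (z i - y)
    · refine (hy i s).trans (hδ' ?_).le
      rw [NNReal.dist_eq] at htδ ⊢
      simp only [NNReal.coe_zero, sub_zero, NNReal.abs_eq] at htδ ⊢
      exact lt_of_le_of_lt (NNReal.coe_le_coe.mpr hs) htδ
  rw [dist_eq_norm]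
  have e : (t : ℝ)⁻¹ • (T t u - u) - y = (t : ℝ)⁻¹ • (T t u - u - (t : ℝ) • y) := by
    rw [smul_sub _ (T t u - u), inv_smul_smul₀ ht'.ne']
  rw [e, norm_smul, Real.norm_of_nonneg (by positivity)]
  calc (t : ℝ)⁻¹ * ‖T t u - u - (t : ℝ) • y‖ ≤ (t : ℝ)⁻¹ * (ε / 2 * t) := by gcongr
    _ = ε / 2 := by field_simp
    _ < ε := half_lt_self hε

end C0Semigroup

/-! ### The Hille–Yosida theorem for contraction semigroups. -/

section HilleYosida

open Set MeasureTheory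

variable {X : Type*} [NormedAddCommGroup X] [NormedSpace ℝ X]

/-- `R` is the resolvent `(l - A)⁻¹`. -/
structure IsResolvent (A : X →ₗ.[ℝ] X) (l : ℝ) (R : X →L[ℝ] X) : Prop where
  mem : ∀ x, R x ∈ A.domain
  sub_apply : ∀ x, l • R x - A ⟨R x, mem x⟩ = x
  apply_sub : ∀ u : A.domain, R (l • (u : X) - A u) = u

/-- The resolvent identity `Q = R + (l - m) R Q` and its mirror image give `(l - m) (R Q - Q R) =
0`; for `l = m` the identity says `Q = R`. -/
lemma IsResolvent.commute {A : X →ₗ.[ℝ] X} {l m : ℝ} {R Q : X →L[ℝ] X} (hR : IsResolvent A l R)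
    (hQ : IsResolvent A m Q) : Commute R Q := by
  have key : ∀ {l m : ℝ} {R Q : X →L[ℝ] X}, IsResolvent A l R → IsResolvent A m Q →
      ∀ x, Q x = R x + (l - m) • R (Q x) := by
    intro l m R Q hR hQ x
    have h1 := hR.apply_sub ⟨Q x, hQ.mem x⟩
    have h2 := hQ.sub_apply x
    have h3 : l • Q x - A ⟨Q x, hQ.mem x⟩ = x + (l - m) • Q x := by
      calc l • Q x - A ⟨Q x, hQ.mem x⟩ = (m • Q x - A ⟨Q x, hQ.mem x⟩) + (l - m) • Q x := by
            module
        _ = _ := by rw [h2]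
    rw [h3, map_add, map_smul] at h1
    exact h1.symm
  refine ContinuousLinearMap.ext fun x => ?_
  by_cases hlm : l = m
  · subst hlm
    have : R = Q := by
      ext x
      have := key hR hQ x
      rw [sub_self, zero_smul, add_zero] at this
      exact this.symm
    rw [this]
  · have h1 := key hR hQ x
    have h2 := key hQ hR x
    have h3 : (l - m) • (R (Q x) - Q (R x)) = 0 := by
      have : (l - m) • R (Q x) = Q x - R x := by rw [eq_sub_iff_add_eq, add_comm]; exact h1.symm
      have h4 : (m - l) • Q (R x) = R x - Q x := by
        rw [eq_sub_iff_add_eq, add_comm]; exact h2.symm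
      calc (l - m) • (R (Q x) - Q (R x)) = (l - m) • R (Q x) + (m - l) • Q (R x) := by module
        _ = 0 := by rw [this, h4]; abel
    exact sub_eq_zero.mp ((smul_eq_zero.mp h3).resolve_left (sub_ne_zero.mpr hlm))

/-- A pointwise limit of contractions is a contraction. -/
lemma exists_clm_of_tendsto {ι : Type*} {l : Filter ι} [l.NeBot] {f : ι → X →L[ℝ] X}
    (hf : ∀ i, ‖f i‖ ≤ 1) (h : ∀ x, ∃ y, Tendsto (fun i => f i x) l (𝓝 y)) :
    ∃ L : X →L[ℝ] X, ‖L‖ ≤ 1 ∧ ∀ x, Tendsto (fun i => f i x) l (𝓝 (L x)) := by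
  choose g hg using h
  let L₀ : X →ₗ[ℝ] X :=
    { toFun := g
      map_add' := fun x y => tendsto_nhds_unique (hg (x + y)) (by
        simpa only [map_add] using (hg x).add (hg y))
      map_smul' := fun c x => tendsto_nhds_unique (hg (c • x)) (by
        simpa only [map_smul, RingHom.id_apply] using (hg x).const_smul c) }
  have hb : ∀ x, ‖L₀ x‖ ≤ 1 * ‖x‖ := fun x =>
    le_of_tendsto (hg x).norm (Eventually.of_forall fun i => (f i).le_of_opNorm_le (hf i) x)
  exact ⟨L₀.mkContinuous 1 hb, L₀.mkContinuous_norm_le zero_le_one hb, hg⟩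

/-- A pointwise limit of contraction `C₀`-semigroups satisfies the semigroup law. -/
lemma map_add_of_tendsto {ι : Type*} {l : Filter ι} [l.NeBot] {V : ι → ℝ≥0 → X →L[ℝ] X}
    {T : ℝ≥0 → X →L[ℝ] X} (hV : ∀ i, IsC0Semigroup (V i)) (hc : ∀ i t, ‖V i t‖ ≤ 1)
    (hlim : ∀ t u, Tendsto (fun i => V i t u) l (𝓝 (T t u))) (s t : ℝ≥0) :
    T (s + t) = (T s).comp (T t) := by
  ext x
  refine tendsto_nhds_unique (hlim (s + t) x) ?_
  have h1 : Tendsto (fun i => V i s (V i t x - T t x)) l (𝓝 0) := by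
    refine squeeze_zero_norm (a := fun i => ‖V i t x - T t x‖) (fun i => ?_)
      (tendsto_iff_norm_sub_tendsto_zero.mp (hlim t x))
    simpa only [one_mul] using (V i s).le_of_opNorm_le (hc i s) (V i t x - T t x)
  refine (by simpa using h1.add (hlim s (T t x)) :
    Tendsto _ l (𝓝 ((T s).comp (T t) x))).congr fun i => ?_
  simp [(hV i).map_add]

lemma cauchySeq_apply_of_dense {f : ℕ → X →L[ℝ] X} (hf : ∀ i, ‖f i‖ ≤ 1) {D : Set X}
    (hD : Dense D) (h : ∀ x ∈ D, CauchySeq fun i => f i x) (x : X) :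
    CauchySeq fun i => f i x := by
  rw [Metric.cauchySeq_iff]
  intro ε hε
  obtain ⟨y, hy, hxy⟩ := hD.exists_dist_lt x (show 0 < ε / 3 by positivity)
  obtain ⟨N, hN⟩ := Metric.cauchySeq_iff.mp (h y hy) (ε / 3) (by positivity)
  refine ⟨N, fun m hm n hn => ?_⟩
  have hd : ∀ i, dist (f i x) (f i y) < ε / 3 := fun i => by
    rw [dist_eq_norm, ← map_sub]
    refine lt_of_le_of_lt ((f i).le_of_opNorm_le (hf i) _) ?_
    rwa [one_mul, ← dist_eq_norm]
  have h1 := dist_triangle4 (f m x) (f m y) (f n y) (f n x)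
  have h2 := hd m
  have h3 := hd n
  have h4 := hN m hm n hn
  rw [dist_comm (f n y)] at h1
  linarith

lemma tendsto_apply_self_of_dense {ι : Type*} {l : Filter ι} {f : ι → X →L[ℝ] X}
    (hf : ∀ i, ‖f i‖ ≤ 1) {D : Set X}
    (hD : Dense D) (h : ∀ x ∈ D, Tendsto (fun i => f i x) l (𝓝 x)) (x : X) :
    Tendsto (fun i => f i x) l (𝓝 x) := by
  rw [Metric.tendsto_nhds]
  intro ε hε
  obtain ⟨y, hy, hxy⟩ := hD.exists_dist_lt x (show 0 < ε / 3 by positivity)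
  filter_upwards [Metric.tendsto_nhds.mp (h y hy) (ε / 3) (by positivity)] with i hi
  have hd : dist (f i x) (f i y) < ε / 3 := by
    rw [dist_eq_norm, ← map_sub]
    refine lt_of_le_of_lt ((f i).le_of_opNorm_le (hf i) _) ?_
    rwa [one_mul, ← dist_eq_norm]
  have h1 := dist_triangle4 (f i x) (f i y) y x
  rw [dist_comm y] at h1
  linarith

/-- The semigroup `exp (t (l² R - l))`, with `R` the resolvent at `l`. -/
def yosida (l : ℝ) (R : X →L[ℝ] X) (t : ℝ≥0) : X →L[ℝ] X :=
  Real.exp (-(t * l)) • NormedSpace.exp ((t : ℝ) • (l ^ 2 • R))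

lemma commute_yosida {l : ℝ} {R Q : X →L[ℝ] X} (h : Commute R Q) (t : ℝ≥0) :
    Commute (yosida l R t) Q := by
  have h1 : Commute (((t : ℝ) • (l ^ 2 • R))) Q := (h.smul_left _).smul_left _
  exact (h1.exp_left).smul_left _

variable [CompleteSpace X]

lemma norm_exp_clm_le (B : X →L[ℝ] X) : ‖NormedSpace.exp B‖ ≤ Real.exp ‖B‖ := by
  have h1 := NormedSpace.exp_series_hasSum_exp' (𝕂 := ℝ) B
  have h2 := NormedSpace.exp_series_hasSum_exp' (𝕂 := ℝ) ‖B‖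
  rw [← Real.exp_eq_exp_ℝ] at h2
  rw [← h1.tsum_eq, ← h2.tsum_eq]
  refine tsum_of_norm_bounded h2.summable.hasSum fun n => ?_
  rw [norm_smul, smul_eq_mul, Real.norm_of_nonneg (by positivity)]
  gcongr
  induction n with
  | zero =>
    -- The space may be trivial, so the identity is only known to have norm at most one.
    rw [pow_zero, pow_zero]
    exact ContinuousLinearMap.norm_id_le
  | succ n ih =>
    rw [pow_succ, pow_succ]
    exact (norm_mul_le _ _).trans (by gcongr)

/-- Since `‖l² R‖ ≤ l`, the exponential is at most `e^{tl}`, which the scalar factor cancels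
exactly. -/
lemma norm_yosida_le {l : ℝ} (hl : 0 ≤ l) {R : X →L[ℝ] X} (hR : ‖l • R‖ ≤ 1) (t : ℝ≥0) :
    ‖yosida l R t‖ ≤ 1 := by
  have h1 : ‖(t : ℝ) • (l ^ 2 • R)‖ ≤ t * l := by
    have : (t : ℝ) • (l ^ 2 • R) = (t * l) • (l • R) := by module
    rw [this, norm_smul, Real.norm_of_nonneg (by positivity)]
    exact mul_le_of_le_one_right (by positivity) hR
  rw [yosida, norm_smul, Real.norm_of_nonneg (Real.exp_pos _).le]
  calc _ ≤ Real.exp (-(t * l)) * Real.exp (t * l) := by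
        gcongr
        exact (norm_exp_clm_le _).trans (Real.exp_le_exp.mpr h1)
    _ = 1 := by rw [← Real.exp_add, neg_add_cancel, Real.exp_zero]

lemma exp_clm_add_of_commute {B C : X →L[ℝ] X} (h : Commute B C) :
    NormedSpace.exp (B + C) = NormedSpace.exp B * NormedSpace.exp C :=
  NormedSpace.exp_add_of_commute_of_mem_ball (𝕂 := ℝ) h
    ((NormedSpace.expSeries_radius_eq_top ℝ (X →L[ℝ] X)).symm ▸ edist_lt_top _ _)
    ((NormedSpace.expSeries_radius_eq_top ℝ (X →L[ℝ] X)).symm ▸ edist_lt_top _ _)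

lemma isOrbitDeriv_yosida (l : ℝ) (R : X →L[ℝ] X) (u : X) :
    IsOrbitDeriv (yosida l R) u (l ^ 2 • R u - l • u) := by
  have h1 : HasDerivAt (fun t : ℝ => Real.exp (-(t * l))) (-l) 0 := by
    have := ((hasDerivAt_mul_const (x := (0 : ℝ)) l).neg).exp
    simpa using this
  have h2 := hasDerivAt_exp_smul_const (𝕂 := ℝ) (𝔸 := X →L[ℝ] X) (l ^ 2 • R) (0 : ℝ)
  have h3 := (h1.smul h2).clm_apply (hasDerivAt_const (0 : ℝ) u)
  have h4 := (hasDerivAt_iff_tendsto_slope.mp h3)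
  refine (Tendsto.congr ?_ (h4.comp tendsto_coe_nhdsNE_zero)).trans_eq ?_
  · intro t
    simp [slope_def_module, yosida]
  · congr 1
    simp
    abel

lemma isC0Semigroup_yosida (l : ℝ) (R : X →L[ℝ] X) : IsC0Semigroup (yosida l R) where
  map_zero := by
    simp only [yosida, NNReal.coe_zero, zero_mul, neg_zero, Real.exp_zero, zero_smul,
      NormedSpace.exp_zero, one_smul]
    rfl
  map_add s t := by
    have h : ((s + t : ℝ≥0) : ℝ) • (l ^ 2 • R) = (s : ℝ) • (l ^ 2 • R) + (t : ℝ) • (l ^ 2 • R) := by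
      push_cast
      module
    have hc : Commute ((s : ℝ) • (l ^ 2 • R)) ((t : ℝ) • (l ^ 2 • R)) :=
      ((Commute.refl (l ^ 2 • R)).smul_left _).smul_right _
    rw [yosida, yosida, yosida, h, exp_clm_add_of_commute hc, NNReal.coe_add, add_mul, neg_add,
      Real.exp_add]
    ext x
    simp [mul_smul, smul_comm (Real.exp (-(t * l)))]
  tendsto_zero u := by
    have h : Continuous fun t : ℝ≥0 => yosida l R t u := by
      have h1 : Continuous fun t : ℝ => NormedSpace.exp (t • (l ^ 2 • R)) :=
        continuous_iff_continuousAt.mpr fun t =>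
          (hasDerivAt_exp_smul_const (𝕂 := ℝ) (𝔸 := X →L[ℝ] X) (l ^ 2 • R) t).continuousAt
      have h2 : Continuous fun t : ℝ≥0 => NormedSpace.exp ((t : ℝ) • (l ^ 2 • R)) :=
        h1.comp NNReal.continuous_coe
      have h3 : Continuous fun t : ℝ≥0 => Real.exp (-(t * l)) := by fun_prop
      exact (h3.smul h2).clm_apply continuous_const
    have h' := h.tendsto 0
    have h0 : yosida l R 0 u = u := by simp [yosida]
    rw [h0] at h'
    exact h'.mono_left nhdsWithin_le_nhds

/-- The Hille–Yosida theorem for contraction semigroups, with the resolvents at a sequence tending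
to infinity. -/
theorem exists_semigroup_of_seq {A : X →ₗ.[ℝ] X} (hA : Dense (A.domain : Set X)) {l : ℕ → ℝ}
    (hl : ∀ k, 0 < l k) (hlim : Tendsto l atTop atTop) {R : ℕ → X →L[ℝ] X}
    (hR : ∀ k, IsResolvent A (l k) (R k)) (hc : ∀ k, ‖l k • R k‖ ≤ 1) :
    ∃ T : ℝ≥0 → X →L[ℝ] X, IsC0Semigroup T ∧ generator T = A ∧ (∀ t, ‖T t‖ ≤ 1) ∧
      ∀ t x, Tendsto (fun k => yosida (l k) (R k) t x) atTop (𝓝 (T t x)) := by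
  have hE : ∀ k, IsC0Semigroup (yosida (l k) (R k)) := fun k => isC0Semigroup_yosida _ _
  have hEc : ∀ k t, ‖yosida (l k) (R k) t‖ ≤ 1 := fun k => norm_yosida_le (hl k).le (hc k)
  have hRn : ∀ k x, ‖R k x‖ ≤ (l k)⁻¹ * ‖x‖ := by
    intro k x
    have h1 := (l k • R k).le_of_opNorm_le (hc k) x
    rw [smul_apply, norm_smul, Real.norm_of_nonneg (hl k).le, one_mul] at h1
    rwa [inv_mul_eq_div, le_div_iff₀' (hl k)]
  -- On the domain the Yosida approximation `l² R - l` of `A` equals `l R A`.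
  have hA1 : ∀ k (u : A.domain), l k • R k (A u) = l k ^ 2 • R k u - l k • (u : X) := by
    intro k u
    have h1 := (hR k).apply_sub u
    rw [map_sub, map_smul] at h1
    conv_rhs => rw [← h1]
    rw [h1]
    nth_rewrite 2 [← h1]
    module
  have hid : ∀ x, Tendsto (fun k => (l k • R k) x) atTop (𝓝 x) := by
    refine tendsto_apply_self_of_dense hc hA fun u hu => ?_
    rw [tendsto_iff_norm_sub_tendsto_zero]
    refine squeeze_zero (fun _ => norm_nonneg _) (g := fun k => (l k)⁻¹ * ‖A ⟨u, hu⟩‖) ?_ ?_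
    · intro k
      have h1 := (hR k).apply_sub ⟨u, hu⟩
      rw [map_sub, map_smul, sub_eq_iff_eq_add'] at h1
      have h2 : (l k • R k) u - u = R k (A ⟨u, hu⟩) := by
        rw [smul_apply, h1]; simp
      rw [h2]
      exact hRn k _
    · simpa using hlim.inv_tendsto_atTop.mul_const ‖A ⟨u, hu⟩‖
  have hAk : ∀ u : A.domain, Tendsto (fun k => l k ^ 2 • R k u - l k • (u : X)) atTop
      (𝓝 (A u)) := by
    intro u
    refine (hid (A u)).congr fun k => ?_
    rw [← hA1 k u, smul_apply]
  have hcauchy : ∀ t x, CauchySeq fun k => yosida (l k) (R k) t x := by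
    intro t
    refine cauchySeq_apply_of_dense (fun k => hEc k t) hA fun u hu => ?_
    have hcs := (hAk ⟨u, hu⟩).cauchySeq
    rw [Metric.cauchySeq_iff] at hcs ⊢
    intro ε hε
    obtain ⟨N, hN⟩ := hcs (ε / (t + 1)) (by positivity)
    refine ⟨N, fun m hm n hn => ?_⟩
    have hNmn := hN m hm n hn
    rw [dist_eq_norm] at hNmn ⊢
    have hcomm := (hR m).commute (hR n)
    -- The approximations commute with both exponentials, so the integrand of the comparison is
    -- bounded by the norm of their difference at `u`, uniformly in time.
    have key := (hE n).norm_sub_le (hE m) (u := u) (t := t)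
      (fun s => isOrbitDeriv_yosida (l n) (R n) (yosida (l m) (R m) s u))
      (fun s => isOrbitDeriv_yosida (l m) (R m) (yosida (l m) (R m) s u))
      (C := ‖l m ^ 2 • R m u - l m • u - (l n ^ 2 • R n u - l n • u)‖) (fun r s _ _ => by
        have e1 : R n (yosida (l m) (R m) s u) = yosida (l m) (R m) s (R n u) :=
          (congrArg (fun B : X →L[ℝ] X => B u)
            (commute_yosida (l := l m) hcomm s)).symm
        have e2 : R m (yosida (l m) (R m) s u) = yosida (l m) (R m) s (R m u) :=
          (congrArg (fun B : X →L[ℝ] X => B u)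
            (commute_yosida (l := l m) (Commute.refl (R m)) s)).symm
        have e3 : l m ^ 2 • R m (yosida (l m) (R m) s u) - l m • yosida (l m) (R m) s u -
            (l n ^ 2 • R n (yosida (l m) (R m) s u) - l n • yosida (l m) (R m) s u) =
            yosida (l m) (R m) s
              (l m ^ 2 • R m u - l m • u - (l n ^ 2 • R n u - l n • u)) := by
          simp only [map_sub, map_smul, e1, e2]
        rw [e3]
        refine ((yosida (l n) (R n) r).le_of_opNorm_le (hEc n r) _).trans ?_
        rw [one_mul]
        refine ((yosida (l m) (R m) s).le_of_opNorm_le (hEc m s) _).trans ?_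
        rw [one_mul])
    refine lt_of_le_of_lt key ?_
    calc _ ≤ ε / (t + 1) * t := by gcongr
      _ < ε := by
        rw [div_mul_eq_mul_div, div_lt_iff₀ (by positivity)]
        nlinarith [t.2]
  choose T hTn hT using fun t => exists_clm_of_tendsto (fun k => hEc k t) fun x =>
    cauchySeq_tendsto_of_complete (hcauchy t x)
  have hEu : ∀ (u : A.domain), ∀ k (t : ℝ≥0), ‖yosida (l k) (R k) t u - u‖ ≤ ‖A u‖ * t := by
    intro u k t
    refine ((hE k).norm_sub_self_le (hEc k) (isOrbitDeriv_yosida _ _ _) t).trans ?_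
    gcongr
    rw [← hA1]
    simpa using (l k • R k).le_of_opNorm_le (hc k) (A u)
  have hC0 : IsC0Semigroup T := by
    refine ⟨?_, map_add_of_tendsto hE hEc hT, ?_⟩
    · ext x
      refine tendsto_nhds_unique (hT 0 x) ?_
      simp only [(hE _).map_zero]
      exact tendsto_const_nhds
    · refine tendsto_apply_self_of_dense hTn hA fun u hu => ?_
      rw [tendsto_iff_norm_sub_tendsto_zero]
      refine squeeze_zero (fun _ => norm_nonneg _) (g := fun t : ℝ≥0 => ‖A ⟨u, hu⟩‖ * t)
        (fun t => le_of_tendsto (((hT t u).sub_const u).norm)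
          (Eventually.of_forall fun k => hEu ⟨u, hu⟩ k t)) ?_
      have : Continuous fun t : ℝ≥0 => ‖A ⟨u, hu⟩‖ * t := by fun_prop
      have h := this.tendsto 0
      rw [NNReal.coe_zero, mul_zero] at h
      exact h.mono_left nhdsWithin_le_nhds
  have hext : ∀ u : A.domain, IsOrbitDeriv T u (A u) := by
    intro u
    rw [IsOrbitDeriv]
    -- A modulus of continuity common to all `k` is needed at `A u`, which need not lie in the
    -- domain; it is obtained by approximation from the domain.
    have hequi : ∀ y : X, Tendsto (fun t : ℝ≥0 => ⨆ k, ‖yosida (l k) (R k) t y - y‖) (𝓝 0)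
        (𝓝 0) := by
      intro y
      rw [Metric.tendsto_nhds]
      intro ε hε
      obtain ⟨w, hw, hyw⟩ := hA.exists_dist_lt y (show 0 < ε / 4 by positivity)
      have h1 : ∀ᶠ t : ℝ≥0 in 𝓝 0, ‖A ⟨w, hw⟩‖ * (t : ℝ) < ε / 4 := by
        have : Continuous fun t : ℝ≥0 => ‖A ⟨w, hw⟩‖ * (t : ℝ) := by fun_prop
        have h := this.tendsto 0
        rw [NNReal.coe_zero, mul_zero] at h
        exact h.eventually_lt_const (by positivity)
      filter_upwards [h1] with t ht
      rw [Real.dist_eq, sub_zero, abs_of_nonneg (Real.iSup_nonneg fun _ => norm_nonneg _)]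
      refine lt_of_le_of_lt (ciSup_le (c := 3 * (ε / 4)) fun k => ?_) (by linarith)
      have h2 : yosida (l k) (R k) t y - y = yosida (l k) (R k) t (y - w) +
          (yosida (l k) (R k) t w - w) + (w - y) := by
        rw [map_sub]; abel
      rw [dist_eq_norm] at hyw
      have h3 : ‖yosida (l k) (R k) t (y - w)‖ ≤ ‖y - w‖ := by
        simpa using (yosida (l k) (R k) t).le_of_opNorm_le (hEc k t) (y - w)
      have h4 := hEu ⟨w, hw⟩ k t
      have h5 := norm_add₃_le (a := yosida (l k) (R k) t (y - w))
        (b := yosida (l k) (R k) t w - w) (c := w - y)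
      rw [h2]
      rw [norm_sub_rev w y] at h5
      simp only at h4
      linarith
    refine isOrbitDeriv_of_tendsto hE hEc hT (Eventually.of_forall fun k =>
      isOrbitDeriv_yosida (l k) (R k) u) (hAk u) (hequi (A u)) fun k s => ?_
    refine le_ciSup (f := fun k => ‖yosida (l k) (R k) s (A u) - A u‖) ?_ k
    refine ⟨‖A u‖ + ‖A u‖, ?_⟩
    rintro _ ⟨k, rfl⟩
    refine (norm_sub_le _ _).trans (add_le_add_left ?_ _)
    simpa using (yosida (l k) (R k) s).le_of_opNorm_le (hEc k s) (A u)
  refine ⟨T, hC0, ?_, hTn, hT⟩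
  -- No proper extension is possible: `l 0 - A` is onto, while `l 0` minus the generator is
  -- injective by dissipativity.
  have hle : ∀ u ∈ (generator T).domain, u ∈ A.domain := by
    rintro u ⟨y, hy⟩
    let v := R 0 (l 0 • u - y)
    have hv : v ∈ A.domain := (hR 0).mem _
    have h1 := (hR 0).sub_apply (l 0 • u - y)
    have h2 := (hy.add ((hext ⟨v, hv⟩).smul (-1))).dissipative hTn (l 0)
    have h3 : l 0 • (u + (-1 : ℝ) • v) - (y + (-1 : ℝ) • A ⟨v, hv⟩) = 0 := by
      calc _ = (l 0 • u - y) - (l 0 • v - A ⟨v, hv⟩) := by module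
        _ = 0 := by rw [h1, sub_self]
    simp only at h2
    rw [h3, norm_zero] at h2
    have h4 : ‖u + (-1 : ℝ) • v‖ = 0 := by
      have := hl 0
      nlinarith [norm_nonneg (u + (-1 : ℝ) • v)]
    have h5 : u = v := by
      have := norm_eq_zero.mp h4
      rwa [neg_one_smul, ← sub_eq_add_neg, sub_eq_zero] at this
    rwa [h5]
  refine LinearPMap.ext (le_antisymm hle fun u hu => ⟨_, hext ⟨u, hu⟩⟩) fun u hu _ => ?_
  exact generator_apply (hext ⟨u, hle u hu⟩) hu

/-- The Hille–Yosida theorem for contraction semigroups. -/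
theorem exists_semigroup_of_resolvent {A : X →ₗ.[ℝ] X} (hA : Dense (A.domain : Set X)) {c : ℝ}
    {R : ℝ → X →L[ℝ] X} (hR : ∀ l > c, IsResolvent A l (R l)) (hc : ∀ l > c, ‖l • R l‖ ≤ 1) :
    ∃ T : ℝ≥0 → X →L[ℝ] X, IsC0Semigroup T ∧ generator T = A ∧ (∀ t, ‖T t‖ ≤ 1) ∧
      ∀ t x, Tendsto (fun n : ℕ => yosida n (R n) t x) atTop (𝓝 (T t x)) := by
  obtain ⟨N, hN⟩ := exists_nat_gt (max c 0)
  have hpos : ∀ k : ℕ, max c 0 < ((k + N : ℕ) : ℝ) := fun k => by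
    push_cast
    have : (0 : ℝ) ≤ k := by positivity
    linarith
  obtain ⟨T, hT, hgen, hTn, hlim⟩ := exists_semigroup_of_seq hA
    (l := fun k => ((k + N : ℕ) : ℝ)) (R := fun k => R ((k + N : ℕ) : ℝ))
    (fun k => (le_max_right _ _).trans_lt (hpos k))
    (tendsto_natCast_atTop_atTop.comp (tendsto_add_atTop_nat N))
    (fun k => hR _ ((le_max_left _ _).trans_lt (hpos k)))
    (fun k => hc _ ((le_max_left _ _).trans_lt (hpos k)))
  -- The shift of the index is removed so that the approximants of two semigroups can be compared at
  -- the same `n`.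
  exact ⟨T, hT, hgen, hTn, fun t x =>
    (tendsto_add_atTop_iff_nat (f := fun n : ℕ => yosida n (R n) t x) N).mp (hlim t x)⟩

end HilleYosida

/-! ### The resolvent as a Laplace transform, and density of the domain. -/

section Laplace

open Set MeasureTheory

variable {X : Type*} [NormedAddCommGroup X] [NormedSpace ℝ X]
  {S : ℝ≥0 → X →L[ℝ] X}

lemma continuous_exp_smul_orbit [CompleteSpace X] (hS : IsC0Semigroup S) (l : ℝ) (x : X) :
    Continuous fun t : ℝ => Real.exp (-(l * t)) • S t.toNNReal x := by
  have h : Continuous fun t : ℝ => S t.toNNReal x :=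
    (hS.continuous x).comp continuous_real_toNNReal
  exact (by fun_prop : Continuous fun t : ℝ => Real.exp (-(l * t))).smul h

lemma norm_exp_smul_orbit_le (hc : ∀ t, ‖S t‖ ≤ 1) (l : ℝ) (x : X) (t : ℝ) :
    ‖Real.exp (-(l * t)) • S t.toNNReal x‖ ≤ Real.exp (-l * t) * ‖x‖ := by
  rw [norm_smul, Real.norm_of_nonneg (Real.exp_pos _).le, neg_mul]
  gcongr
  simpa using (S t.toNNReal).le_of_opNorm_le (hc _) x

variable [CompleteSpace X]

lemma integrableOn_exp_smul_orbit (hS : IsC0Semigroup S) (hc : ∀ t, ‖S t‖ ≤ 1) {l : ℝ}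
    (hl : 0 < l) (x : X) :
    IntegrableOn (fun t : ℝ => Real.exp (-(l * t)) • S t.toNNReal x) (Ioi 0) :=
  Integrable.mono' ((exp_neg_integrableOn_Ioi 0 hl).mul_const ‖x‖)
    (continuous_exp_smul_orbit hS l x).aestronglyMeasurable
    (Eventually.of_forall fun t => norm_exp_smul_orbit_le hc l x t)

/-- The Laplace transform of a contraction semigroup is the resolvent of its generator. -/
theorem exists_isResolvent_laplace (hS : IsC0Semigroup S) (hc : ∀ t, ‖S t‖ ≤ 1) {l : ℝ}
    (hl : 0 < l) : ∃ R : X →L[ℝ] X, IsResolvent (generator S) l R ∧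
      ∀ x, R x = ∫ t : ℝ in Ioi 0, Real.exp (-(l * t)) • S t.toNNReal x := by
  have hint := integrableOn_exp_smul_orbit hS hc hl
  have hcont := continuous_exp_smul_orbit hS l
  let R₀ : X →ₗ[ℝ] X :=
    { toFun := fun x => ∫ t : ℝ in Ioi 0, Real.exp (-(l * t)) • S t.toNNReal x
      map_add' := fun x y => by
        rw [← integral_add (hint x) (hint y)]
        simp
      map_smul' := fun c x => by
        rw [RingHom.id_apply, ← integral_smul]
        simp [smul_comm c] }
  have hR₀ : ∀ x, ‖R₀ x‖ ≤ (∫ t : ℝ in Ioi 0, Real.exp (-l * t)) * ‖x‖ := fun x => by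
    rw [← integral_mul_const]
    exact norm_integral_le_of_norm_le ((exp_neg_integrableOn_Ioi 0 hl).mul_const ‖x‖)
      (Eventually.of_forall fun t => norm_exp_smul_orbit_le hc l x t)
  let R : X →L[ℝ] X := R₀.mkContinuous _ hR₀
  have hR : ∀ x, R x = ∫ t : ℝ in Ioi 0, Real.exp (-(l * t)) • S t.toNNReal x := fun x => rfl
  -- Substituting `t ↦ t + s` turns `S s (R x)` into `e^{ls}` times the Laplace integral over `(s,
  -- ∞)`, which can be differentiated at `s = 0`.
  have horbit : ∀ x (s : ℝ≥0), S s (R x) =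
      Real.exp (l * s) • (R x - ∫ t in (0 : ℝ)..s, Real.exp (-(l * t)) • S t.toNNReal x) := by
    intro x s
    rw [hR, ← intervalIntegral.integral_Ioi_sub_Ioi (hint x) s.coe_nonneg, sub_sub_cancel,
      ← ContinuousLinearMap.integral_comp_comm _ (hint x), ← integral_smul]
    have h := (measurePreserving_add_right volume (s : ℝ)).setIntegral_preimage_emb
      (MeasurableEquiv.addRight (s : ℝ)).measurableEmbedding
      (fun t => Real.exp (l * s) • Real.exp (-(l * t)) • S t.toNNReal x) (Ioi (s : ℝ))
    rw [← h, preimage_add_const_Ioi, sub_self]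
    refine setIntegral_congr_fun measurableSet_Ioi fun t ht => ?_
    have e1 : S (t + s).toNNReal x = S s (S t.toNNReal x) := by
      rw [Real.toNNReal_add (le_of_lt ht) s.coe_nonneg, Real.toNNReal_coe, add_comm, hS.map_add,
        ContinuousLinearMap.comp_apply]
    simp only [map_smul, e1, smul_smul, ← Real.exp_add]
    congr 2
    ring
  have hderiv : ∀ x, IsOrbitDeriv S (R x) (l • R x - x) := by
    intro x
    have h1 : HasDerivAt (fun s : ℝ => ∫ t in (0 : ℝ)..s, Real.exp (-(l * t)) • S t.toNNReal x)
        (Real.exp (-(l * 0)) • S (0 : ℝ).toNNReal x) 0 :=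
      intervalIntegral.integral_hasDerivAt_right ((hcont x).intervalIntegrable _ _)
        ((hcont x).stronglyMeasurableAtFilter _ _) (hcont x).continuousAt
    have h2 : HasDerivAt (fun s : ℝ => Real.exp (l * s)) l 0 := by
      have := ((hasDerivAt_id (0 : ℝ)).const_mul l).exp
      simpa using this
    have h3 := hasDerivAt_iff_tendsto_slope.mp (h2.smul (h1.const_sub (R x)))
    refine (Tendsto.congr ?_ (h3.comp tendsto_coe_nhdsNE_zero)).trans_eq ?_
    · intro t
      simp [slope_def_module, horbit x t]
    · congr 1
      simp [hS.map_zero]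
      abel
  have hmem : ∀ x, R x ∈ (generator S).domain := fun x => mem_generator_domain (hderiv x)
  have hsub : ∀ x, l • R x - generator S ⟨R x, hmem x⟩ = x := fun x => by
    rw [generator_apply (hderiv x)]
    abel
  refine ⟨R, ⟨hmem, hsub, fun u => ?_⟩, hR⟩
  -- The vector `u - R (l u - A u)`, with `A` the generator, lies in the kernel of `l - A`, which is
  -- trivial by dissipativity.
  have h1 := generator_spec S u
  have h2 := (h1.add ((hderiv (l • (u : X) - generator S u)).smul (-1))).dissipative hc l
  have h3 : l • ((u : X) + (-1 : ℝ) • R (l • (u : X) - generator S u)) - (generator S u +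
      (-1 : ℝ) • (l • R (l • (u : X) - generator S u) - (l • (u : X) - generator S u))) = 0 := by
    module
  rw [h3, norm_zero] at h2
  have h4 : ‖(u : X) + (-1 : ℝ) • R (l • (u : X) - generator S u)‖ = 0 := by
    nlinarith [norm_nonneg ((u : X) + (-1 : ℝ) • R (l • (u : X) - generator S u))]
  have h5 := norm_eq_zero.mp h4
  rw [neg_one_smul, ← sub_eq_add_neg, sub_eq_zero] at h5
  exact h5.symm

/-- The generator of a contraction semigroup is densely defined. -/
theorem dense_generator_domain (hS : IsC0Semigroup S) (hc : ∀ t, ‖S t‖ ≤ 1) :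
    Dense ((generator S).domain : Set X) := by
  obtain ⟨R, hR, -⟩ := exists_isResolvent_laplace hS hc one_pos
  intro x
  have h1 : IsOrbitDeriv S (R x) (generator S ⟨R x, hR.mem x⟩) :=
    generator_spec S ⟨R x, hR.mem x⟩
  have h2 : generator S ⟨R x, hR.mem x⟩ = R x - x := by
    have := hR.sub_apply x
    rw [one_smul, sub_eq_iff_eq_add] at this
    rw [eq_sub_iff_add_eq, add_comm]
    exact this.symm
  rw [h2] at h1
  -- The difference quotients of the orbit of `R x` tend to `R x - x`; subtracted from `R x` they
  -- stay in the domain and tend to `x`.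
  have h3 := h1.const_sub (R x)
  rw [sub_sub_cancel] at h3
  refine mem_closure_of_tendsto h3 (Eventually.of_forall fun t => ?_)
  refine Submodule.sub_mem _ (hR.mem x) (Submodule.smul_mem _ _ (Submodule.sub_mem _ ?_ (hR.mem x)))
  exact mem_generator_domain ((generator_spec S ⟨R x, hR.mem x⟩).apply hS t)

end Laplace

/-! ### The self-adjoint trace class as an ordered Banach space. -/

section TraceClass

variable {ℋ : Type*} [NormedAddCommGroup ℋ] [InnerProductSpace ℂ ℋ] [CompleteSpace ℋ]

/-- All terms are nonnegative, so the sums over `n` and over the basis may be exchanged. -/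
lemma posTrace_tsum {P : ℕ → ℋ →L[ℂ] ℋ} (hP : ∀ n, 0 ≤ P n) (hs : Summable P) :
    posTrace (∑' n, P n) = ∑' n, posTrace (P n) := by
  unfold posTrace posTraceOn
  rw [ENNReal.tsum_comm]
  congr 1
  funext i
  have h : HasSum (fun n => (inner ℂ (stdBasis ℋ i) (P n (stdBasis ℋ i))).re)
      (inner ℂ (stdBasis ℋ i) ((∑' n, P n) (stdBasis ℋ i))).re :=
    Complex.hasSum_re ((((ContinuousLinearMap.apply ℂ ℋ (stdBasis ℋ i)).hasSum
      hs.hasSum)).mapL (innerSL ℂ (stdBasis ℋ i)))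
  rw [← h.tsum_eq]
  exact ENNReal.ofReal_tsum_of_nonneg (fun n => inner_re_nonneg (hP n) _) h.summable

/-- The Hilbert–Schmidt norm of `√A`, whose square is the trace of `A`, dominates its operator norm:
move `√A` onto the basis vectors and apply Cauchy–Schwarz. -/
lemma norm_sq_sqrt_apply_le {A : ℋ →L[ℂ] ℋ} (hA : 0 ≤ A) (x : ℋ) :
    ENNReal.ofReal (‖CFC.sqrt A x‖ ^ 2) ≤ posTrace A * ENNReal.ofReal (‖x‖ ^ 2) := by
  have hs : IsSelfAdjoint (CFC.sqrt A) := IsSelfAdjoint.of_nonneg (CFC.sqrt_nonneg A)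
  have hsym := ContinuousLinearMap.isSelfAdjoint_iff_isSymmetric.mp hs
  unfold posTrace posTraceOn
  rw [← tsum_inner_sq (stdBasis ℋ), ← ENNReal.tsum_mul_right]
  refine ENNReal.tsum_le_tsum fun i => ?_
  rw [inner_eq_norm_sqrt hA, ← ENNReal.ofReal_mul (by positivity)]
  refine ENNReal.ofReal_le_ofReal ?_
  have : inner ℂ (stdBasis ℋ i) (CFC.sqrt A x) = inner ℂ (CFC.sqrt A (stdBasis ℋ i)) x :=
    (hsym (stdBasis ℋ i) x).symm
  rw [this, ← mul_pow]
  gcongr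
  exact norm_inner_le_norm _ _

lemma norm_le_posTrace {A : ℋ →L[ℂ] ℋ} (hA : 0 ≤ A) (h : posTrace A < ∞) :
    ‖A‖ ≤ (posTrace A).toReal := by
  have h1 : ‖CFC.sqrt A‖ ≤ √(posTrace A).toReal := by
    refine ContinuousLinearMap.opNorm_le_bound _ (Real.sqrt_nonneg _) fun x => ?_
    have h2 := norm_sq_sqrt_apply_le hA x
    rw [← ENNReal.ofReal_toReal h.ne, ← ENNReal.ofReal_mul ENNReal.toReal_nonneg,
      ENNReal.ofReal_le_ofReal_iff (by positivity)] at h2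
    refine le_of_sq_le_sq ?_ (by positivity)
    rwa [mul_pow, Real.sq_sqrt ENNReal.toReal_nonneg]
  calc ‖A‖ = ‖CFC.sqrt A * CFC.sqrt A‖ := by rw [CFC.sqrt_mul_sqrt_self A hA]
    _ ≤ ‖CFC.sqrt A‖ * ‖CFC.sqrt A‖ := norm_mul_le _ _
    _ ≤ √(posTrace A).toReal * √(posTrace A).toReal := by gcongr
    _ = _ := Real.mul_self_sqrt ENNReal.toReal_nonneg

namespace TraceClassSA

lemma le_def {u v : TraceClassSA ℋ} : u ≤ v ↔ u.toOp ≤ v.toOp := Iff.rfl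

lemma nonneg_def {u : TraceClassSA ℋ} : 0 ≤ u ↔ 0 ≤ u.toOp := Iff.rfl

variable (ℋ) in
/-- The inclusion of the self-adjoint trace-class operators into the bounded operators. -/
def toOpₗ : TraceClassSA ℋ →ₗ[ℝ] (ℋ →L[ℂ] ℋ) := (traceClassSubmodule ℋ).subtype

lemma toOp_injective : Function.Injective (toOp : TraceClassSA ℋ → ℋ →L[ℂ] ℋ) :=
  Subtype.val_injective

lemma toOp_add (u v : TraceClassSA ℋ) : (u + v).toOp = u.toOp + v.toOp := rfl

lemma toOp_sub (u v : TraceClassSA ℋ) : (u - v).toOp = u.toOp - v.toOp := rfl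

lemma toOp_smul (r : ℝ) (u : TraceClassSA ℋ) : (r • u).toOp = r • u.toOp := rfl

instance : IsOrderedAddMonoid (TraceClassSA ℋ) where
  add_le_add_left u v h w := by
    rw [le_def] at h ⊢
    rw [toOp_add, toOp_add]
    gcongr

instance : IsOrderedModule ℝ (TraceClassSA ℋ) :=
  IsOrderedModule.of_smul_nonneg fun a ha b hb => by
    rw [nonneg_def] at hb ⊢
    rw [toOp_smul]
    exact smul_nonneg ha hb

/-- A positive operator with finite trace. -/
def ofNonneg (A : ℋ →L[ℂ] ℋ) (hA : 0 ≤ A) (h : posTrace A < ∞) : TraceClassSA ℋ :=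
  ⟨A, IsSelfAdjoint.of_nonneg hA, by rwa [IsTraceClass, CFC.abs_of_nonneg A hA]⟩

lemma toOp_ofNonneg (A : ℋ →L[ℂ] ℋ) (hA : 0 ≤ A) (h : posTrace A < ∞) :
    (ofNonneg A hA h).toOp = A := rfl

lemma posTrace_toOp {u : TraceClassSA ℋ} (hu : 0 ≤ u) :
    posTrace u.toOp = ENNReal.ofReal ‖u‖ := by
  have h : posTrace (CFC.abs u.toOp) < ∞ := u.2.2
  rw [norm_def, ENNReal.ofReal_toReal h.ne, CFC.abs_of_nonneg _ (nonneg_def.mp hu)]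

/-- The decomposition of an operator into its positive and negative part. -/
lemma exists_nonneg_sub (u : TraceClassSA ℋ) :
    ∃ p q : TraceClassSA ℋ, 0 ≤ p ∧ 0 ≤ q ∧ u = p - q ∧ ‖p‖ + ‖q‖ = ‖u‖ := by
  have hsa : IsSelfAdjoint u.toOp := u.2.1
  have hfin : posTrace (CFC.abs u.toOp) < ∞ := u.2.2
  have hfin' := hfin
  rw [posTrace_abs hsa, ENNReal.add_lt_top] at hfin'
  have hp := CFC.posPart_nonneg u.toOp
  have hq := CFC.negPart_nonneg u.toOp
  refine ⟨ofNonneg _ hp hfin'.1, ofNonneg _ hq hfin'.2, hp, hq, toOp_injective ?_, ?_⟩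
  · exact (CFC.posPart_sub_negPart u.toOp hsa).symm
  · rw [norm_def u, posTrace_abs hsa, ENNReal.toReal_add hfin'.1.ne hfin'.2.ne, norm_def,
      norm_def, toOp_ofNonneg, toOp_ofNonneg, CFC.abs_of_nonneg _ hp, CFC.abs_of_nonneg _ hq]

lemma norm_toOp_le (u : TraceClassSA ℋ) : ‖u.toOp‖ ≤ ‖u‖ := by
  have hpos : ∀ p : TraceClassSA ℋ, 0 ≤ p → ‖p.toOp‖ ≤ ‖p‖ := by
    intro p hp
    have h := posTrace_toOp hp
    have h1 := norm_le_posTrace (nonneg_def.mp hp) (h ▸ ENNReal.ofReal_lt_top)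
    rwa [h, ENNReal.toReal_ofReal (norm_nonneg _)] at h1
  obtain ⟨p, q, hp, hq, hu, hn⟩ := exists_nonneg_sub u
  rw [← hn]
  conv_lhs => rw [hu, toOp_sub]
  exact (norm_sub_le _ _).trans (add_le_add (hpos p hp) (hpos q hq))

variable (ℋ) in
/-- The inclusion of the self-adjoint trace-class operators into the bounded operators, as a
continuous linear map. -/
def toOpL : TraceClassSA ℋ →L[ℝ] (ℋ →L[ℂ] ℋ) :=
  (toOpₗ ℋ).mkContinuous 1 fun u => by
    rw [one_mul]
    exact norm_toOp_le u

lemma continuous_toOp : Continuous (toOp : TraceClassSA ℋ → ℋ →L[ℂ] ℋ) := (toOpL ℋ).continuous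

/-- The trace norm dominates the operator norm, in which the order is closed. -/
instance : OrderClosedTopology (TraceClassSA ℋ) where
  isClosed_le' := by
    have : {p : TraceClassSA ℋ × TraceClassSA ℋ | p.1 ≤ p.2} =
        {p | p.1.toOp ≤ p.2.toOp} := rfl
    rw [this]
    exact isClosed_le (continuous_toOp.comp continuous_fst) (continuous_toOp.comp continuous_snd)

/-- The series converges in operator norm. By countable additivity of the trace, the trace norm of a
remainder is the tail of `∑ ‖p n‖`. -/
lemma exists_tendsto_sum_of_nonneg {p : ℕ → TraceClassSA ℋ} (hp : ∀ n, 0 ≤ p n)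
    (hs : Summable fun n => ‖p n‖) :
    ∃ a, Tendsto (fun n => ∑ i ∈ Finset.range n, p i) atTop (𝓝 a) := by
  have hP : ∀ n, 0 ≤ (p n).toOp := fun n => nonneg_def.mp (hp n)
  have hsP : Summable fun n => (p n).toOp :=
    Summable.of_norm_bounded hs fun n => norm_toOp_le (p n)
  have htr : ∀ N, posTrace (∑' n, (p (n + N)).toOp) = ENNReal.ofReal (∑' n, ‖p (n + N)‖) := by
    intro N
    rw [posTrace_tsum (fun n => hP (n + N)) ((summable_nat_add_iff N).mpr hsP),
      ENNReal.ofReal_tsum_of_nonneg (fun n => norm_nonneg _) ((summable_nat_add_iff N).mpr hs)]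
    exact tsum_congr fun n => posTrace_toOp (hp (n + N))
  let a := ofNonneg (∑' n, (p n).toOp) (tsum_nonneg hP) (by
    have := htr 0
    simp only [add_zero] at this
    exact this ▸ ENNReal.ofReal_lt_top)
  have ha : ∀ N, (a - ∑ i ∈ Finset.range N, p i).toOp = ∑' n, (p (n + N)).toOp := by
    intro N
    have h1 : (∑ i ∈ Finset.range N, p i).toOp = ∑ i ∈ Finset.range N, (p i).toOp :=
      map_sum (toOpₗ ℋ) _ _
    rw [toOp_sub, h1, toOp_ofNonneg, sub_eq_iff_eq_add', hsP.sum_add_tsum_nat_add N]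
  refine ⟨a, tendsto_iff_norm_sub_tendsto_zero.mpr ?_⟩
  refine (tendsto_sum_nat_add fun n => ‖p n‖).congr fun N => ?_
  have hnn : 0 ≤ a - ∑ i ∈ Finset.range N, p i := by
    rw [nonneg_def, ha]
    exact tsum_nonneg fun n => hP (n + N)
  have h2 := posTrace_toOp hnn
  rw [ha, htr, ENNReal.ofReal_eq_ofReal_iff (tsum_nonneg fun n => norm_nonneg _)
    (norm_nonneg _)] at h2
  rw [h2, norm_sub_rev]

instance : CompleteSpace (TraceClassSA ℋ) := by
  refine NormedAddCommGroup.completeSpace_of_summable_imp_tendsto fun u hu => ?_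
  choose p q hp hq hpq hn using fun n => exists_nonneg_sub (u n)
  obtain ⟨a, ha⟩ := exists_tendsto_sum_of_nonneg hp
    (Summable.of_nonneg_of_le (fun _ => norm_nonneg _)
      (fun n => (hn n).le.trans' (by simp)) hu)
  obtain ⟨b, hb⟩ := exists_tendsto_sum_of_nonneg hq
    (Summable.of_nonneg_of_le (fun _ => norm_nonneg _)
      (fun n => (hn n).le.trans' (by simp)) hu)
  refine ⟨a - b, (ha.sub hb).congr fun n => ?_⟩
  rw [← Finset.sum_sub_distrib]
  exact Finset.sum_congr rfl fun i _ => (hpq i).symm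

lemma tr_add (u v : TraceClassSA ℋ) : (u + v).tr = u.tr + v.tr := by
  refine (hasSum_tr (stdBasis ℋ) (u + v)).unique ?_
  simpa [toOp_add] using (hasSum_tr (stdBasis ℋ) u).add (hasSum_tr (stdBasis ℋ) v)

lemma tr_smul (r : ℝ) (u : TraceClassSA ℋ) : (r • u).tr = r * u.tr := by
  refine (hasSum_tr (stdBasis ℋ) (r • u)).unique ?_
  refine ((hasSum_tr (stdBasis ℋ) u).mul_left r).congr_fun fun i => ?_
  rw [toOp_smul, smul_apply, ← Complex.coe_smul, inner_smul_right, Complex.re_ofReal_mul]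

variable (ℋ) in
/-- The trace as a continuous linear functional. -/
def trL : TraceClassSA ℋ →L[ℝ] ℝ :=
  LinearMap.mkContinuous
    { toFun := tr
      map_add' := tr_add
      map_smul' := tr_smul } 1 fun u => by
    obtain ⟨p, q, hp, hq, hu, hn⟩ := exists_nonneg_sub u
    have h : u.tr + q.tr = p.tr := by rw [← tr_add, hu, sub_add_cancel]
    rw [one_mul, ← hn, LinearMap.coe_mk, AddHom.coe_mk, Real.norm_eq_abs, abs_le,
      norm_eq_tr p hp, norm_eq_tr q hq]
    have h1 : 0 ≤ p.tr := norm_eq_tr p hp ▸ norm_nonneg p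
    have h2 : 0 ≤ q.tr := norm_eq_tr q hq ▸ norm_nonneg q
    constructor <;> linarith

lemma trL_apply (u : TraceClassSA ℋ) : trL ℋ u = u.tr := rfl

lemma tr_sub (u v : TraceClassSA ℋ) : (u - v).tr = u.tr - v.tr := map_sub (trL ℋ) u v

lemma tr_nonneg {u : TraceClassSA ℋ} (hu : 0 ≤ u) : 0 ≤ u.tr :=
  norm_eq_tr u hu ▸ norm_nonneg u

lemma tr_mono {u v : TraceClassSA ℋ} (h : u ≤ v) : u.tr ≤ v.tr := by
  have := tr_nonneg (sub_nonneg.mpr h)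
  rw [tr_sub] at this
  linarith

lemma tr_le_norm (u : TraceClassSA ℋ) : u.tr ≤ ‖u‖ := by
  obtain ⟨p, q, hp, hq, hu, hn⟩ := exists_nonneg_sub u
  rw [← hn, norm_eq_tr p hp, norm_eq_tr q hq, hu, tr_sub]
  linarith [tr_nonneg hq]

lemma norm_sub_of_le {u v : TraceClassSA ℋ} (h : u ≤ v) : ‖v - u‖ = v.tr - u.tr := by
  rw [norm_eq_tr _ (sub_nonneg.mpr h), tr_sub]

/-- A linear operator is bounded by its values on the positive cone. -/
lemma norm_le_of_nonneg {E : Type*} [SeminormedAddCommGroup E] [NormedSpace ℝ E]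
    (f : TraceClassSA ℋ →ₗ[ℝ] E) {C : ℝ} (h : ∀ u, 0 ≤ u → ‖f u‖ ≤ C * ‖u‖)
    (u : TraceClassSA ℋ) : ‖f u‖ ≤ C * ‖u‖ := by
  obtain ⟨p, q, hp, hq, hu, hn⟩ := exists_nonneg_sub u
  rw [← hn, mul_add, hu, map_sub]
  exact (norm_sub_le _ _).trans (add_le_add (h p hp) (h q hq))

/-- An increasing net of operators with bounded traces converges in trace norm. -/
lemma exists_tendsto_of_monotone {J : Type*} [Preorder J] [IsDirectedOrder J] [Nonempty J]
    {f : J → TraceClassSA ℋ} (hf : Monotone f) {C : ℝ} (hC : ∀ j, (f j).tr ≤ C) :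
    ∃ a, Tendsto f atTop (𝓝 a) := by
  have hlim : Tendsto (fun j => (f j).tr) atTop (𝓝 (⨆ j, (f j).tr)) :=
    tendsto_atTop_ciSup (fun i j h => tr_mono (hf h)) ⟨C, by rintro _ ⟨j, rfl⟩; exact hC j⟩
  have hle : ∀ j, (f j).tr ≤ ⨆ j, (f j).tr := fun j =>
    le_ciSup (f := fun j => (f j).tr) ⟨C, by rintro _ ⟨j, rfl⟩; exact hC j⟩ j
  refine CompleteSpace.complete (f := map f atTop) (Metric.cauchy_iff.mpr ⟨inferInstance, ?_⟩)
  intro ε hε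
  -- Beyond `j₀` the distance to `f j₀` is a difference of traces, hence less than `ε / 2`.
  obtain ⟨j₀, hj₀⟩ := (hlim.eventually_const_lt (sub_lt_self _ (half_pos hε))).exists
  refine ⟨f '' Set.Ici j₀, image_mem_map (Ici_mem_atTop j₀), ?_⟩
  rintro _ ⟨j, hj, rfl⟩ _ ⟨k, hk, rfl⟩
  have h1 := dist_triangle_right (f j) (f k) (f j₀)
  rw [dist_eq_norm (f j) (f j₀), dist_eq_norm (f k) (f j₀), norm_sub_of_le (hf hj),
    norm_sub_of_le (hf hk)] at h1
  linarith [hle j, hle k]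

lemma eq_of_inner_eq_on_dense {u v : TraceClassSA ℋ} {V : Set ℋ} (hV : Dense V)
    (h : ∀ x ∈ V, inner ℂ (u.toOp x) x = inner ℂ (v.toOp x) x) : u = v := by
  have h1 : ∀ x, inner ℂ (u.toOp x) x = inner ℂ (v.toOp x) x := fun x =>
    congrFun ((by fun_prop : Continuous fun x => inner ℂ (u.toOp x) x).ext_on hV
      (by fun_prop) h) x
  refine toOp_injective (ContinuousLinearMap.ext fun x => ?_)
  -- Polarisation: over `ℂ` the quadratic form determines the operator.
  have h2 := (ext_inner_map (u.toOp : ℋ →ₗ[ℂ] ℋ) (v.toOp : ℋ →ₗ[ℂ] ℋ)).mp h1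
  exact congrArg (fun L : ℋ →ₗ[ℂ] ℋ => L x) h2

end TraceClassSA

end TraceClass

/-! ### Positivity and monotonicity of exponentials. -/

section OrderedYosida

variable {X : Type*} [NormedAddCommGroup X] [NormedSpace ℝ X] [PartialOrder X]
  [IsOrderedAddMonoid X]

lemma pow_apply_mono {P Q : X →L[ℝ] X} (hP : ∀ u, 0 ≤ u → 0 ≤ P u)
    (hPQ : ∀ u, 0 ≤ u → P u ≤ Q u) {u : X} (hu : 0 ≤ u) (n : ℕ) :
    0 ≤ (P ^ n) u ∧ (P ^ n) u ≤ (Q ^ n) u := by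
  induction n with
  | zero => simpa using hu
  | succ n ih =>
    simp only [pow_succ', mul_apply_eq_comp]
    refine ⟨hP _ ih.1, (hPQ _ ih.1).trans ?_⟩
    rw [← sub_nonneg, ← map_sub]
    have h := sub_nonneg.mpr ih.2
    exact (hP _ h).trans (hPQ _ h)

variable [CompleteSpace X] [IsOrderedModule ℝ X] [OrderClosedTopology X]

lemma exp_apply_mono {P Q : X →L[ℝ] X} (hP : ∀ u, 0 ≤ u → 0 ≤ P u)
    (hPQ : ∀ u, 0 ≤ u → P u ≤ Q u) {u : X} (hu : 0 ≤ u) :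
    0 ≤ NormedSpace.exp P u ∧ NormedSpace.exp P u ≤ NormedSpace.exp Q u := by
  have hsum : ∀ B : X →L[ℝ] X,
      HasSum (fun n : ℕ => ((n.factorial : ℝ)⁻¹) • (B ^ n) u) (NormedSpace.exp B u) := fun B =>
    (NormedSpace.exp_series_hasSum_exp' (𝕂 := ℝ) B).mapL (ContinuousLinearMap.apply ℝ X u)
  refine ⟨(hsum P).nonneg fun n => ?_, hasSum_le (fun n => ?_) (hsum P) (hsum Q)⟩
  · exact smul_nonneg (by positivity) (pow_apply_mono hP hPQ hu n).1
  · exact smul_le_smul_of_nonneg_left (pow_apply_mono hP hPQ hu n).2 (by positivity)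

/-- The operator `l² P - l` need not be positive; with the scalar factor split off, what remains is
a power series in `P` with nonnegative coefficients. -/
lemma yosida_apply_mono {P Q : X →L[ℝ] X} (hP : ∀ u, 0 ≤ u → 0 ≤ P u)
    (hPQ : ∀ u, 0 ≤ u → P u ≤ Q u) (l : ℝ) (t : ℝ≥0) {u : X} (hu : 0 ≤ u) :
    0 ≤ yosida l P t u ∧ yosida l P t u ≤ yosida l Q t u := by
  have h := exp_apply_mono (P := (t : ℝ) • (l ^ 2 • P)) (Q := (t : ℝ) • (l ^ 2 • Q))
    (fun u hu => smul_nonneg t.coe_nonneg (smul_nonneg (sq_nonneg l) (hP u hu)))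
    (fun u hu => smul_le_smul_of_nonneg_left
      (smul_le_smul_of_nonneg_left (hPQ u hu) (sq_nonneg l)) t.coe_nonneg) hu
  exact ⟨smul_nonneg (Real.exp_pos _).le h.1,
    smul_le_smul_of_nonneg_left h.2 (Real.exp_pos _).le⟩

end OrderedYosida

/-! ### Relatively bounded positive perturbations of the generator. -/

section Perturbation

open TraceClassSA

variable {ℋ : Type*} [NormedAddCommGroup ℋ] [InnerProductSpace ℂ ℋ] [CompleteSpace ℋ]
  {H : TraceClassSA ℋ →ₗ.[ℝ] TraceClassSA ℋ}

lemma IsDynamicalSemigroup.exists_isResolvent {S : ℝ≥0 → TraceClassSA ℋ →L[ℝ] TraceClassSA ℋ}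
    (hS : IsDynamicalSemigroup S) {l : ℝ} (hl : 0 < l) :
    ∃ R : TraceClassSA ℋ →L[ℝ] TraceClassSA ℋ, IsResolvent (generator S) l R ∧
      ∀ u, 0 ≤ u → 0 ≤ R u := by
  obtain ⟨R, hR, hint⟩ := exists_isResolvent_laplace hS.toIsC0Semigroup hS.contraction hl
  refine ⟨R, hR, fun u hu => ?_⟩
  rw [hint]
  exact MeasureTheory.integral_nonneg fun t =>
    smul_nonneg (Real.exp_pos _).le (hS.positivity _ u hu)

lemma IsResolvent.apply_mem_neg_subOp {B : H.domain →ₗ[ℝ] TraceClassSA ℋ} {l : ℝ}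
    {Q : TraceClassSA ℋ →L[ℝ] TraceClassSA ℋ} (hQ : IsResolvent (-subOp H B) l Q)
    (x : TraceClassSA ℋ) : Q x ∈ H.domain := hQ.mem x

lemma IsResolvent.smul_add_sub {B : H.domain →ₗ[ℝ] TraceClassSA ℋ} {l : ℝ}
    {Q : TraceClassSA ℋ →L[ℝ] TraceClassSA ℋ} (hQ : IsResolvent (-subOp H B) l Q)
    (x : TraceClassSA ℋ) : l • Q x + (H ⟨Q x, hQ.apply_mem_neg_subOp x⟩ -
      B ⟨Q x, hQ.apply_mem_neg_subOp x⟩) = x := by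
  have h := hQ.sub_apply x
  rw [LinearPMap.neg_apply, sub_neg_eq_add] at h
  exact h

lemma IsResolvent.apply_smul_add_sub {B : H.domain →ₗ[ℝ] TraceClassSA ℋ} {l : ℝ}
    {Q : TraceClassSA ℋ →L[ℝ] TraceClassSA ℋ} (hQ : IsResolvent (-subOp H B) l Q)
    (u : H.domain) : Q (l • (u : TraceClassSA ℋ) + (H u - B u)) = u := by
  have h : Q (l • (u : TraceClassSA ℋ) - -(H u - B u)) = u := hQ.apply_sub u
  rwa [sub_neg_eq_add] at h

/-- The second resolvent identity `P = Q - Q (C - B) P`, in which the subtracted term is positive.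
-/
lemma IsResolvent.apply_mono {B C : H.domain →ₗ[ℝ] TraceClassSA ℋ} {l : ℝ}
    {P Q : TraceClassSA ℋ →L[ℝ] TraceClassSA ℋ} (hP : IsResolvent (-subOp H B) l P)
    (hQ : IsResolvent (-subOp H C) l Q) (hP0 : ∀ u, 0 ≤ u → 0 ≤ P u)
    (hQ0 : ∀ u, 0 ≤ u → 0 ≤ Q u) (hBC : PositivityPreserving (C - B)) {x : TraceClassSA ℋ}
    (hx : 0 ≤ x) : P x ≤ Q x := by
  set v : H.domain := ⟨P x, hP.apply_mem_neg_subOp x⟩ with hv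
  have h1 : l • (v : TraceClassSA ℋ) + (H v - B v) = x := hP.smul_add_sub x
  have h2 := hQ.apply_smul_add_sub v
  have h3 : l • (v : TraceClassSA ℋ) + (H v - C v) = x - (C - B) v := by
    rw [← h1, LinearMap.sub_apply]; abel
  rw [h3, map_sub] at h2
  have h4 : 0 ≤ Q ((C - B) v) := hQ0 _ (hBC v (hP0 x hx))
  have h5 : P x = Q x - Q ((C - B) v) := h2.symm
  rw [h5]
  exact sub_le_self _ h4

/-- The resolvent of a relatively bounded positive perturbation. -/
lemma exists_isResolvent_subOp {l : ℝ} (hl : 0 < l)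
    {R : TraceClassSA ℋ →L[ℝ] TraceClassSA ℋ} (hR : IsResolvent (-H) l R)
    (hR0 : ∀ u, 0 ≤ u → 0 ≤ R u) {B : H.domain →ₗ[ℝ] TraceClassSA ℋ}
    (hB : PositivityPreserving B)
    (hBH : ∀ u : H.domain, 0 ≤ (u : TraceClassSA ℋ) → (B u).tr ≤ (H u).tr) {a b : ℝ}
    (hb0 : 0 ≤ b) (hb : b < 1)
    (hab : ∀ u : H.domain, 0 ≤ (u : TraceClassSA ℋ) →
      (B u).tr ≤ a * (u : TraceClassSA ℋ).tr + b * (H u).tr) (hal : a ≤ b * l) :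
    ∃ Q : TraceClassSA ℋ →L[ℝ] TraceClassSA ℋ, IsResolvent (-subOp H B) l Q ∧
      (∀ u, 0 ≤ u → 0 ≤ Q u) ∧ ‖l • Q‖ ≤ 1 := by
  have hmem : ∀ x, R x ∈ H.domain := hR.mem
  have hRH : ∀ x, l • R x + H ⟨R x, hmem x⟩ = x := fun x => by
    have h := hR.sub_apply x
    rwa [LinearPMap.neg_apply, sub_neg_eq_add] at h
  have hHR : ∀ u : H.domain, R (l • (u : TraceClassSA ℋ) + H u) = u := fun u => by
    have h := hR.apply_sub u
    rwa [LinearPMap.neg_apply, sub_neg_eq_add] at h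
  let G₀ : TraceClassSA ℋ →ₗ[ℝ] TraceClassSA ℋ :=
    B ∘ₗ (R : TraceClassSA ℋ →ₗ[ℝ] TraceClassSA ℋ).codRestrict H.domain hmem
  have hG₀ : ∀ x, G₀ x = B ⟨R x, hmem x⟩ := fun x => rfl
  -- For `x ≥ 0`, the trace of `l Rx + HRx = x` turns `a Tr Rx + b Tr HRx` into `b Tr x + (a - b l)
  -- Tr Rx`, and `hal` makes the last term nonpositive.
  have hG₀b : ∀ x, ‖G₀ x‖ ≤ b * ‖x‖ := norm_le_of_nonneg G₀ fun x hx => by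
    have h1 : (0 : TraceClassSA ℋ) ≤ G₀ x := hB ⟨R x, hmem x⟩ (hR0 x hx)
    have h2 := hab ⟨R x, hmem x⟩ (hR0 x hx)
    have h3 := congrArg tr (hRH x)
    rw [tr_add, tr_smul] at h3
    have h4 := tr_nonneg (hR0 x hx)
    rw [norm_eq_tr _ h1, norm_eq_tr _ hx, hG₀, ← h3]
    simp only at h2
    nlinarith [mul_le_mul_of_nonneg_right hal h4]
  let G : TraceClassSA ℋ →L[ℝ] TraceClassSA ℋ := G₀.mkContinuous b hG₀b
  have hG : ∀ x, G x = B ⟨R x, hmem x⟩ := hG₀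
  have hGn : ‖G‖ < 1 := (G₀.mkContinuous_norm_le hb0 hG₀b).trans_lt hb
  -- Since `l + H - B = (1 - G) (l + H)`, the resolvent is `R (1 - G)⁻¹`; the Neumann series shows
  -- that it is positive.
  let N : TraceClassSA ℋ →L[ℝ] TraceClassSA ℋ := ∑' n : ℕ, G ^ n
  have hN1 : ∀ x, N x - B ⟨R (N x), hmem _⟩ = x := fun x => by
    have h := congrArg (fun L : TraceClassSA ℋ →L[ℝ] TraceClassSA ℋ => L x)
      (mul_neg_geom_series G hGn)
    simpa [sub_mul, hG] using h
  have hN2 : ∀ x, N (x - B ⟨R x, hmem x⟩) = x := fun x => by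
    have h := congrArg (fun L : TraceClassSA ℋ →L[ℝ] TraceClassSA ℋ => L x)
      (geom_series_mul_neg G hGn)
    rw [← hG]
    simpa [mul_sub] using h
  have hN0 : ∀ x, 0 ≤ x → 0 ≤ N x := fun x hx => by
    have h : HasSum (fun n : ℕ => (G ^ n) x) (N x) :=
      (summable_geometric_of_norm_lt_one hGn).hasSum.mapL
        (ContinuousLinearMap.apply ℝ (TraceClassSA ℋ) x)
    have hG0 : ∀ u, 0 ≤ u → 0 ≤ G u := fun u hu => hB ⟨R u, hmem u⟩ (hR0 u hu)
    exact h.nonneg fun n => (pow_apply_mono hG0 (fun _ _ => le_rfl) hx n).1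
  have hQ0 : ∀ u, 0 ≤ u → 0 ≤ (R.comp N) u := fun u hu => hR0 _ (hN0 u hu)
  have hres : IsResolvent (-subOp H B) l (R.comp N) := by
    refine ⟨fun x => hmem (N x), fun x => ?_, fun u => ?_⟩
    · rw [LinearPMap.neg_apply, sub_neg_eq_add]
      show l • R (N x) + (H ⟨R (N x), hmem _⟩ - B ⟨R (N x), hmem _⟩) = x
      rw [← add_sub_assoc, hRH, hN1]
    · rw [LinearPMap.neg_apply, sub_neg_eq_add]
      obtain ⟨u, hu⟩ := u
      show R (N (l • u + (H ⟨u, hu⟩ - B ⟨u, hu⟩))) = u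
      have h1 := hHR ⟨u, hu⟩
      simp only at h1
      have h2 := hN2 (l • u + H ⟨u, hu⟩)
      have h3 : B ⟨R (l • u + H ⟨u, hu⟩), hmem _⟩ = B ⟨u, hu⟩ := by
        congr 1
        exact Subtype.ext h1
      rw [h3, add_sub_assoc] at h2
      rw [h2, h1]
  refine ⟨R.comp N, hres, hQ0, ?_⟩
  refine ContinuousLinearMap.opNorm_le_bound _ zero_le_one ?_
  refine norm_le_of_nonneg ((l • R.comp N : TraceClassSA ℋ →L[ℝ] TraceClassSA ℋ) :
    TraceClassSA ℋ →ₗ[ℝ] TraceClassSA ℋ) fun x hx => ?_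
  -- In the trace of `l Qx + (H - B) Qx = x` the second term is nonnegative, so `l Tr Qx ≤ Tr x`.
  have h1 := congrArg tr (hres.smul_add_sub x)
  rw [tr_add, tr_sub] at h1
  have h2 := hBH ⟨_, hres.apply_mem_neg_subOp x⟩ (hQ0 x hx)
  rw [one_mul, norm_eq_tr x hx]
  show ‖l • (R.comp N) x‖ ≤ _
  rw [norm_eq_tr _ (smul_nonneg hl.le (hQ0 x hx))]
  linarith

/-- `T` is the positive contraction semigroup generated by `-(H - B)`, obtained from positive
resolvents. -/
structure IsPerturbedSemigroup (H : TraceClassSA ℋ →ₗ.[ℝ] TraceClassSA ℋ)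
    (B : H.domain →ₗ[ℝ] TraceClassSA ℋ) (T : ℝ≥0 → TraceClassSA ℋ →L[ℝ] TraceClassSA ℋ) : Prop
    extends IsDynamicalSemigroup T where
  generator_eq : generator T = -subOp H B
  yosida_limit : ∃ (c : ℝ) (Q : ℝ → TraceClassSA ℋ →L[ℝ] TraceClassSA ℋ),
    (∀ l > c, IsResolvent (-subOp H B) l (Q l) ∧ ∀ u, 0 ≤ u → 0 ≤ Q l u) ∧
    ∀ t x, Tendsto (fun n : ℕ => yosida n (Q n) t x) atTop (𝓝 (T t x))

/-- A positive perturbation `K` of `H` with `Tr K ≤ Tr H` and relative bound smaller than one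
yields the generator `-(H - K)` of a dynamical semigroup. -/
theorem exists_isPerturbedSemigroup {S : ℝ≥0 → TraceClassSA ℋ →L[ℝ] TraceClassSA ℋ}
    (hS : IsDynamicalSemigroup S) (hH : generator S = -H) {B : H.domain →ₗ[ℝ] TraceClassSA ℋ}
    (hB : PositivityPreserving B)
    (hBH : ∀ u : H.domain, 0 ≤ (u : TraceClassSA ℋ) → (B u).tr ≤ (H u).tr)
    (hab : ∃ a b : ℝ, 0 ≤ a ∧ 0 ≤ b ∧ b < 1 ∧ ∀ u : H.domain, 0 ≤ (u : TraceClassSA ℋ) →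
      (B u).tr ≤ a * (u : TraceClassSA ℋ).tr + b * (H u).tr) :
    ∃ T, IsPerturbedSemigroup H B T := by
  obtain ⟨a, b, ha, hb0, hb, hab⟩ := hab
  have hdense : Dense ((-subOp H B).domain : Set (TraceClassSA ℋ)) := by
    have h := dense_generator_domain hS.toIsC0Semigroup hS.contraction
    rw [hH] at h
    exact h
  -- The bound `b` may be zero. It is replaced by `(b + 1) / 2`, still less than one but positive,
  -- so that `a ≤ l (b + 1) / 2` for large `l`. This uses `Tr Hu ≥ Tr Bu ≥ 0`.
  have hb' : 0 < (b + 1) / 2 := by linarith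
  have key : ∀ l : ℝ, a / ((b + 1) / 2) < l →
      ∃ Q : TraceClassSA ℋ →L[ℝ] TraceClassSA ℋ, IsResolvent (-subOp H B) l Q ∧
      (∀ u, 0 ≤ u → 0 ≤ Q u) ∧ ‖l • Q‖ ≤ 1 := by
    intro l hl
    have hl0 : 0 < l := lt_of_le_of_lt (by positivity) hl
    obtain ⟨R, hR, hR0⟩ := hS.exists_isResolvent hl0
    rw [hH] at hR
    refine exists_isResolvent_subOp hl0 hR hR0 hB hBH (a := a) hb'.le (by linarith) (fun u hu => ?_)
      ((div_le_iff₀' hb').mp hl.le)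
    have h1 := tr_nonneg (hB u hu)
    have h2 := hBH u hu
    have h3 := hab u hu
    nlinarith
  choose! Q hQ hQ0 hQn using key
  obtain ⟨T, hT, hgen, hTn, hlim⟩ := exists_semigroup_of_resolvent hdense hQ hQn
  refine ⟨T, ⟨⟨hT, hTn, fun t u hu => ?_⟩, hgen, _, Q, fun l hl => ⟨hQ l hl, hQ0 l hl⟩, hlim⟩⟩
  refine ge_of_tendsto (hlim t u) ?_
  filter_upwards [tendsto_natCast_atTop_atTop.eventually_gt_atTop (a / ((b + 1) / 2))] with n hn
  exact (yosida_apply_mono (hQ0 n hn) (fun _ _ => le_rfl) n t hu).1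

/-- Domination passes from the resolvents to the Yosida approximants and then to the limit; this is
why `yosida_limit` is recorded. -/
lemma IsPerturbedSemigroup.apply_mono {B C : H.domain →ₗ[ℝ] TraceClassSA ℋ}
    {T U : ℝ≥0 → TraceClassSA ℋ →L[ℝ] TraceClassSA ℋ} (hT : IsPerturbedSemigroup H B T)
    (hU : IsPerturbedSemigroup H C U) (hBC : PositivityPreserving (C - B)) (t : ℝ≥0)
    {u : TraceClassSA ℋ} (hu : 0 ≤ u) : T t u ≤ U t u := by
  obtain ⟨c, P, hP, hPlim⟩ := hT.yosida_limit
  obtain ⟨d, Q, hQ, hQlim⟩ := hU.yosida_limit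
  refine le_of_tendsto_of_tendsto (hPlim t u) (hQlim t u) ?_
  filter_upwards [tendsto_natCast_atTop_atTop.eventually_gt_atTop c,
    tendsto_natCast_atTop_atTop.eventually_gt_atTop d] with n hc hd
  exact (yosida_apply_mono (hP n hc).2
    (fun x hx => (hP n hc).1.apply_mono (hQ n hd).1 (hP n hc).2 (hQ n hd).2 hBC hx) n t hu).2

lemma IsDynamicalSemigroup.tr_le {T : ℝ≥0 → TraceClassSA ℋ →L[ℝ] TraceClassSA ℋ}
    (hT : IsDynamicalSemigroup T) (t : ℝ≥0) {u : TraceClassSA ℋ} (hu : 0 ≤ u) :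
    (T t u).tr ≤ u.tr := by
  rw [← norm_eq_tr u hu, ← norm_eq_tr _ (hT.positivity t u hu)]
  simpa using (T t).le_of_opNorm_le (hT.contraction t) u

/-- As `T u - S u ≥ 0`, its norm is `Tr Tu - Tr Su ≤ Tr (u - Su) ≤ ‖Su - u‖`. This bounds the
perturbed semigroups near time zero by the unperturbed one. -/
lemma norm_apply_sub_le_of_le {T S : TraceClassSA ℋ →L[ℝ] TraceClassSA ℋ} {u : TraceClassSA ℋ}
    (h : S u ≤ T u) (htr : (T u).tr ≤ u.tr) : ‖T u - u‖ ≤ 2 * ‖S u - u‖ := by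
  have h1 := norm_sub_of_le h
  have h2 := tr_le_norm (u - S u)
  rw [tr_sub, norm_sub_rev] at h2
  have h3 := norm_add_le (T u - S u) (S u - u)
  rw [sub_add_sub_cancel] at h3
  linarith

end Perturbation

/-! ### Limits along a functional regularisation, and trace preservation. -/

section Regularisation

open TraceClassSA

variable {ℋ : Type*} [NormedAddCommGroup ℋ] [InnerProductSpace ℂ ℋ] [CompleteSpace ℋ]
  {J : Type*} [Preorder J] {S : ℝ≥0 → TraceClassSA ℋ →L[ℝ] TraceClassSA ℋ}
  {H : TraceClassSA ℋ →ₗ.[ℝ] TraceClassSA ℋ} {K : H.domain →ₗ[ℝ] TraceClassSA ℋ}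
  {Kα : J → H.domain →ₗ[ℝ] TraceClassSA ℋ}
  {Tα : J → ℝ≥0 → TraceClassSA ℋ →L[ℝ] TraceClassSA ℋ}

/-- The domain is the range of the positive resolvent at one: decompose `u + H u` and apply the
resolvent. Properties of `D(H)⁺` thus extend to `D(H)`. -/
lemma IsDynamicalSemigroup.exists_nonneg_sub_domain (hS : IsDynamicalSemigroup S)
    (hH : generator S = -H) (u : H.domain) :
    ∃ p q : H.domain, 0 ≤ (p : TraceClassSA ℋ) ∧ 0 ≤ (q : TraceClassSA ℋ) ∧ u = p - q := by
  obtain ⟨R, hR, hR0⟩ := hS.exists_isResolvent one_pos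
  rw [hH] at hR
  obtain ⟨p, q, hp, hq, hpq, -⟩ := exists_nonneg_sub ((1 : ℝ) • (u : TraceClassSA ℋ) - -(H u))
  have h : R ((1 : ℝ) • (u : TraceClassSA ℋ) - -(H u)) = u := hR.apply_sub u
  refine ⟨⟨R p, hR.mem p⟩, ⟨R q, hR.mem q⟩, hR0 p hp, hR0 q hq, Subtype.ext ?_⟩
  rw [← h, hpq, map_sub]
  rfl

lemma IsFunctionalRegularisation.apply_mono (hKα : IsFunctionalRegularisation H K Kα)
    {u : H.domain} (hu : 0 ≤ (u : TraceClassSA ℋ)) : Monotone fun α => Kα α u :=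
  fun α β h => sub_nonneg.mp (hKα.mono α β h u hu)

lemma IsFunctionalRegularisation.apply_le (hKα : IsFunctionalRegularisation H K Kα)
    {u : H.domain} (hu : 0 ≤ (u : TraceClassSA ℋ)) (α : J) : Kα α u ≤ K u :=
  sub_nonneg.mp (hKα.le α u hu)

section Directed

variable [IsDirectedOrder J] [Nonempty J]

/-- A functional regularisation converges in trace norm. -/
lemma IsFunctionalRegularisation.tendsto_apply (hKα : IsFunctionalRegularisation H K Kα)
    (hS : IsDynamicalSemigroup S) (hH : generator S = -H) (u : H.domain) :
    Tendsto (fun α => Kα α u) atTop (𝓝 (K u)) := by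
  have key : ∀ u : H.domain, 0 ≤ (u : TraceClassSA ℋ) →
      Tendsto (fun α => Kα α u) atTop (𝓝 (K u)) := by
    intro u hu
    -- Monotonicity already gives a trace-norm limit; the weak convergence on `V` only identifies
    -- it.
    obtain ⟨w, hw⟩ := exists_tendsto_of_monotone (hKα.apply_mono hu)
      (fun α => tr_mono (hKα.apply_le hu α))
    obtain ⟨V, hV, hVlim⟩ := hKα.tendsto u hu
    suffices w = K u by rwa [this] at hw
    refine eq_of_inner_eq_on_dense hV fun x hx => tendsto_nhds_unique ?_ (hVlim x hx)
    have hcont : Continuous fun v : TraceClassSA ℋ => inner ℂ (v.toOp x) x :=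
      (continuous_toOp.clm_apply continuous_const).inner continuous_const
    exact (hcont.tendsto w).comp hw
  obtain ⟨p, q, hp, hq, rfl⟩ := hS.exists_nonneg_sub_domain hH u
  simpa only [map_sub] using (key p hp).sub (key q hq)

lemma IsPerturbedSemigroup.exists_limit (hKα : IsFunctionalRegularisation H K Kα)
    (hT : ∀ α, IsPerturbedSemigroup H (Kα α) (Tα α)) (t : ℝ≥0) :
    ∃ L : TraceClassSA ℋ →L[ℝ] TraceClassSA ℋ, ‖L‖ ≤ 1 ∧
      ∀ u, Tendsto (fun α => Tα α t u) atTop (𝓝 (L u)) := by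
  refine exists_clm_of_tendsto (fun α => (hT α).contraction t) fun u => ?_
  have key : ∀ p : TraceClassSA ℋ, 0 ≤ p → ∃ y, Tendsto (fun α => Tα α t p) atTop (𝓝 y) :=
    fun p hp => exists_tendsto_of_monotone
      (fun α β h => (hT α).apply_mono (hT β) (hKα.mono α β h) t hp)
      (fun α => (hT α).tr_le t hp)
  obtain ⟨p, q, hp, hq, rfl, -⟩ := exists_nonneg_sub u
  obtain ⟨y, hy⟩ := key p hp
  obtain ⟨z, hz⟩ := key q hq
  exact ⟨y - z, by simpa only [map_sub] using hy.sub hz⟩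

/-- The perturbed semigroups dominate the unperturbed one. -/
lemma IsPerturbedSemigroup.le_apply (hS : IsDynamicalSemigroup S) (hH : generator S = -H)
    {B : H.domain →ₗ[ℝ] TraceClassSA ℋ} (hB : PositivityPreserving B)
    (hBH : ∀ u : H.domain, 0 ≤ (u : TraceClassSA ℋ) → (B u).tr ≤ (H u).tr)
    {T : ℝ≥0 → TraceClassSA ℋ →L[ℝ] TraceClassSA ℋ} (hT : IsPerturbedSemigroup H B T) (t : ℝ≥0)
    {u : TraceClassSA ℋ} (hu : 0 ≤ u) : S t u ≤ T t u := by
  have htr0 : ((0 : TraceClassSA ℋ)).tr = 0 := map_zero (trL ℋ)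
  have hH0 : ∀ u : H.domain, 0 ≤ (u : TraceClassSA ℋ) → 0 ≤ (H u).tr := fun u hu =>
    (tr_nonneg (hB u hu)).trans (hBH u hu)
  -- The semigroup `S` is reconstructed as the perturbation by zero, so that the comparison through
  -- Yosida approximants covers it.
  obtain ⟨U, hU⟩ := exists_isPerturbedSemigroup hS hH (B := 0) (fun _ _ => le_rfl)
    (fun u hu => by simpa [htr0] using hH0 u hu)
    ⟨0, 0, le_rfl, le_rfl, one_pos, fun u hu => by simp [htr0]⟩
  have hgen : generator S = generator U := by
    rw [hH, hU.generator_eq]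
    have : subOp H 0 = H := LinearPMap.ext rfl fun u hu hu' => by
      show H ⟨u, hu⟩ - 0 = _
      rw [sub_zero]
    rw [this]
  have hSU : S = U := hS.toIsC0Semigroup.eq_of_generator_eq hU.toIsC0Semigroup hgen
    (dense_generator_domain hS.toIsC0Semigroup hS.contraction)
  rw [hSU]
  exact hU.apply_mono hT (by simpa using hB) t hu

/-- The limit of the perturbed semigroups is a dynamical semigroup, whose generator extends
`-(H - K)`. -/
theorem isDynamicalSemigroup_of_tendsto (hS : IsDynamicalSemigroup S) (hH : generator S = -H)
    (hKα : IsFunctionalRegularisation H K Kα)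
    (hKH : ∀ u : H.domain, 0 ≤ (u : TraceClassSA ℋ) → (K u).tr ≤ (H u).tr)
    (hT : ∀ α, IsPerturbedSemigroup H (Kα α) (Tα α))
    {T : ℝ≥0 → TraceClassSA ℋ →L[ℝ] TraceClassSA ℋ}
    (hlim : ∀ t u, Tendsto (fun α => Tα α t u) atTop (𝓝 (T t u))) :
    IsDynamicalSemigroup T ∧ ∀ u : H.domain, IsOrbitDeriv T u (-(H u - K u)) := by
  have hωS : ∀ y : TraceClassSA ℋ, Tendsto (fun s => 2 * ‖S s y - y‖) (𝓝 0) (𝓝 0) := fun y => by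
    have := ((hS.tendsto_nhds_zero y).sub_const y).norm.const_mul 2
    simpa using this
  have hbound : ∀ α s (y : TraceClassSA ℋ), 0 ≤ y → ‖Tα α s y - y‖ ≤ 2 * ‖S s y - y‖ :=
    fun α s y hy => norm_apply_sub_le_of_le
      ((hT α).le_apply hS hH (hKα.positivity α) (fun u hu =>
        (tr_mono (hKα.apply_le hu α)).trans (hKH u hu)) s hy) ((hT α).tr_le s hy)
  have hequi : ∀ y : TraceClassSA ℋ, ∃ ω : ℝ≥0 → ℝ, Tendsto ω (𝓝 0) (𝓝 0) ∧
      ∀ α s, ‖Tα α s y - y‖ ≤ ω s := by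
    intro y
    obtain ⟨p, q, hp, hq, rfl, -⟩ := exists_nonneg_sub y
    refine ⟨fun s => 2 * ‖S s p - p‖ + 2 * ‖S s q - q‖, by simpa using (hωS p).add (hωS q),
      fun α s => ?_⟩
    rw [map_sub, sub_sub_sub_comm]
    exact (norm_sub_le _ _).trans (add_le_add (hbound α s p hp) (hbound α s q hq))
  refine ⟨⟨⟨?_, map_add_of_tendsto (fun α => (hT α).toIsC0Semigroup)
    (fun α => (hT α).contraction) hlim, fun u => ?_⟩, fun t => ?_, fun t u hu => ?_⟩, fun u => ?_⟩
  · ext1 u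
    refine tendsto_nhds_unique (hlim 0 u) ?_
    simp only [(hT _).map_zero]
    exact tendsto_const_nhds
  · obtain ⟨ω, hω, hωb⟩ := hequi u
    rw [tendsto_iff_norm_sub_tendsto_zero]
    exact squeeze_zero (fun _ => norm_nonneg _) (fun s =>
      le_of_tendsto ((hlim s u).sub_const u).norm
      (Eventually.of_forall fun α => hωb α s)) (hω.mono_left nhdsWithin_le_nhds)
  · refine ContinuousLinearMap.opNorm_le_bound _ zero_le_one fun u => ?_
    exact le_of_tendsto (hlim t u).norm (Eventually.of_forall fun α =>
      (Tα α t).le_of_opNorm_le ((hT α).contraction t) u)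
  · exact ge_of_tendsto (hlim t u) (Eventually.of_forall fun α => (hT α).positivity t u hu)
  -- The derivatives `-(H u - Kα α u)` converge in trace norm and the modulus at the limit does not
  -- depend on `α`, so the derivative passes to the limit.
  · obtain ⟨ω, hω, hωb⟩ := hequi (-(H u - K u))
    refine isOrbitDeriv_of_tendsto (z := fun α => -(H u - Kα α u))
      (fun α => (hT α).toIsC0Semigroup) (fun α => (hT α).contraction) hlim
      (Eventually.of_forall fun α => ?_) ((hKα.tendsto_apply hS hH u).const_sub (H u)).neg hω hωb
    rw [isOrbitDeriv_iff, (hT α).generator_eq]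
    exact ⟨u.2, rfl⟩

end Directed

/-- A dynamical semigroup is trace preserving if the trace vanishes on the values of its generator
on a core. -/
theorem IsDynamicalSemigroup.isMarkov_of_hasCore {T : ℝ≥0 → TraceClassSA ℋ →L[ℝ] TraceClassSA ℋ}
    (hT : IsDynamicalSemigroup T) {D : Submodule ℝ (TraceClassSA ℋ)}
    (hcore : (generator T).HasCore D)
    (htr : ∀ u ∈ D, ∀ y, IsOrbitDeriv T u y → y.tr = 0) : IsMarkovDynamicalSemigroup T := by
  have hgen : ∀ u y, IsOrbitDeriv T u y → y.tr = 0 := by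
    intro u y hy
    obtain ⟨hu, huy⟩ := isOrbitDeriv_iff.mp hy
    have hclosed : IsClosed {p : TraceClassSA ℋ × TraceClassSA ℋ | p.2.tr = 0} :=
      isClosed_eq ((trL ℋ).continuous.comp continuous_snd) continuous_const
    have hsub : (((generator T).domRestrict D).graph : Set (TraceClassSA ℋ × TraceClassSA ℋ)) ⊆
        {p | p.2.tr = 0} := by
      rintro ⟨v, z⟩ hvz
      obtain ⟨w, hw1, hw2⟩ := (LinearPMap.mem_graph_iff _).mp hvz
      obtain ⟨w, hwD, hwdom⟩ := w
      simp only at hw1 hw2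
      subst hw1
      refine htr w hwD z (isOrbitDeriv_iff.mpr ⟨hwdom, ?_⟩)
      rw [← hw2]
      exact (LinearPMap.domRestrict_apply (x := ⟨w, hwD, hwdom⟩) (y := ⟨w, hwdom⟩) rfl).symm
    have hmem : (u, y) ∈ (generator T).graph :=
      (LinearPMap.mem_graph_iff _).mpr ⟨⟨u, hu⟩, rfl, huy⟩
    -- Closedness of the generator is not needed: the closure of a map that is not closable is by
    -- convention the map itself, and then the core is the whole domain.
    by_cases hc : ((generator T).domRestrict D).IsClosable
    · have h := hc.graph_closure_eq_closure_graph
      rw [hcore.closure_eq] at h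
      rw [← h] at hmem
      exact closure_minimal hsub hclosed hmem
    · have h := LinearPMap.closure_def' hc
      rw [hcore.closure_eq] at h
      rw [h] at hmem
      exact hsub hmem
  refine ⟨hT, fun t u => ?_⟩
  have hd := dense_generator_domain hT.toIsC0Semigroup hT.contraction
  have key : Set.EqOn (fun u => trL ℋ (T t u)) (fun u => trL ℋ u)
      ((generator T).domain : Set (TraceClassSA ℋ)) := by
    rintro v ⟨y, hy⟩
    have hcont : ContinuousOn (fun s : ℝ => trL ℋ (T s.toNNReal v)) (Set.Icc 0 (t : ℝ)) :=
      ((trL ℋ).continuous.comp ((hT.continuous v).comp continuous_real_toNNReal)).continuousOn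
    have h := constant_of_has_deriv_right_zero hcont (fun s hs => ?_) t ⟨t.coe_nonneg, le_rfl⟩
    · simpa [hT.map_zero] using h
    · have h1 := (trL ℋ).hasFDerivAt.comp_hasDerivWithinAt s
        (hy.hasDerivWithinAt hT.toIsC0Semigroup hs.1)
      have h2 : trL ℋ (T s.toNNReal y) = 0 :=
        hgen _ _ (hy.apply hT.toIsC0Semigroup s.toNNReal)
      rw [h2] at h1
      exact h1
  exact congrFun (((trL ℋ).continuous.comp (T t).continuous).ext_on hd (trL ℋ).continuous key) u

end Regularisation

end KatoReg

end

open KatoReg in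
theorem theorem2p10 {ℋ : Type*} [NormedAddCommGroup ℋ] [InnerProductSpace ℂ ℋ] [CompleteSpace ℋ]
    {J : Type*} [Preorder J] [IsDirectedOrder J] [Nonempty J]
    (S : ℝ≥0 → KatoReg.TraceClassSA ℋ →L[ℝ] KatoReg.TraceClassSA ℋ)
    (hS : KatoReg.IsDynamicalSemigroup S)
    (H : KatoReg.TraceClassSA ℋ →ₗ.[ℝ] KatoReg.TraceClassSA ℋ)
    (hH : KatoReg.generator S = -H)
    (K : H.domain →ₗ[ℝ] KatoReg.TraceClassSA ℋ)
    (hK : KatoReg.PositivityPreserving K)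
    (hKH : ∀ u : H.domain, 0 ≤ (u : KatoReg.TraceClassSA ℋ) → (K u).tr ≤ (H u).tr)
    (Kα : J → H.domain →ₗ[ℝ] KatoReg.TraceClassSA ℋ)
    (hKα : KatoReg.IsFunctionalRegularisation H K Kα)
    (hzero : ∀ u : H.domain, (H u - K u).tr = 0) :
    (∃! T : ℝ≥0 → KatoReg.TraceClassSA ℋ →L[ℝ] KatoReg.TraceClassSA ℋ,
      KatoReg.IsRegularisedSemigroup H Kα T) ∧
    ∀ T : ℝ≥0 → KatoReg.TraceClassSA ℋ →L[ℝ] KatoReg.TraceClassSA ℋ,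
      KatoReg.IsRegularisedSemigroup H Kα T →
      (KatoReg.generator T).HasCore H.domain →
      KatoReg.IsMarkovDynamicalSemigroup T := by
  have hex : ∀ α, ∃ T, IsPerturbedSemigroup H (Kα α) T := fun α =>
    exists_isPerturbedSemigroup hS hH (hKα.positivity α)
      (fun u hu => (TraceClassSA.tr_mono (hKα.apply_le hu α)).trans (hKH u hu))
      (hKα.trace_bound α)
  choose Tα hTα using hex
  have hlim : ∀ T, IsRegularisedSemigroup H Kα T →
      ∀ t u, Tendsto (fun α => Tα α t u) atTop (𝓝 (T t u)) := by
    rintro T ⟨Uα, hUα, hU⟩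
    -- Each approximating semigroup is determined by its densely defined generator, so the limit
    -- does not depend on the chosen family.
    have : Uα = Tα := by
      funext α
      refine ((hTα α).toIsC0Semigroup.eq_of_generator_eq (hUα α).1
        ((hTα α).generator_eq.trans (hUα α).2.symm)
        (dense_generator_domain (hTα α).toIsC0Semigroup (hTα α).contraction)).symm
    rwa [this] at hU
  refine ⟨?_, fun T hT hcore => ?_⟩
  · choose T _ hT using IsPerturbedSemigroup.exists_limit hKα hTα
    refine ⟨T, ⟨Tα, fun α => ⟨(hTα α).toIsC0Semigroup, (hTα α).generator_eq⟩, hT⟩, fun U hU => ?_⟩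
    funext t
    exact ContinuousLinearMap.ext fun u => tendsto_nhds_unique (hlim U hU t u) (hT t u)
  · obtain ⟨hdyn, hderiv⟩ := isDynamicalSemigroup_of_tendsto hS hH hKα hKH hTα (hlim T hT)
    refine hdyn.isMarkov_of_hasCore hcore fun u hu y hy => ?_
    rw [hy.unique (hderiv ⟨u, hu⟩), ← neg_eq_zero, ← hzero ⟨u, hu⟩]
    rw [← TraceClassSA.trL_apply, map_neg, neg_neg, TraceClassSA.trL_apply]
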